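/- Let $m,k\ge 1$ be integers. Let $S$ be the unit hypercube $[0,1)^m$ regarded as a torus, equipped with the torus metric derived from the Euclidean norm, or with any equivalent metric (one that induces the same topology and for which there is a ball of every prescribed volume in $(0,1)$ around every point). Divide $S$ into the $k^m$ hypercubes $\mathcal R_\ell = I_{j_1}\times\dots\times I_{j_m}$, $0\le j_1,\dots,j_m<k$, where $I_j=[j/k,(j+1)/k)$. Let $\rho_\ell\ge 0$ be densities with $\sum_\ell q_\ell=1$, where $q_\ell=\rho_\ell k^{-m}$, and let $\rho$ be the density function on $S$ with value $\rho_\ell$ on $\mathcal R_\ell$. Let $A_1,A_2>0$ and $p\in(0,1)$ satisfy $pA_1\max_\ell\rho_\ell<1$. All these parameters are fixed. The inhomogeneous SPA model generates random directed graphs $(G_t)_{t\ge 0}$ as follows. $G_0$ is the null graph. At each time step $t\ge1$ a new node $v_t\in S$ is chosen with density $\rho$, independently of the past, and then, independently for each earlier node $u$ with $v_t\in S(u,t-1)$, a directed link $(v_t,u)$ is created with probability $p$. Here the sphere of influence $S(u,t)$ is the ball centred at $u$ of volume $(A_1\deg^-(u,t)+A_2)/t$, where $\deg^-(u,t)$ is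 the in-degree of $u$ in $G_t$, and $S(u,t)=S$ if this number is at least $1$. For a node $v$ let $\mathcal R(v)$ be the hypercube containing $v$. An event holds asymptotically almost surely (a.a.s.) if its probability tends to $1$ as $n\to\infty$; $o(\cdot)$ refers to $n\to\infty$. Then: 1. A.a.s., for all regions $\mathcal R_\ell$, $|V(G_n)\cap\mathcal R_\ell|=(1+o(1))\,q_\ell n$. 2. For every region $\mathcal R_\ell$, $$\mathbb E\bigl(|\{(u,v)\in E(G_n) : u,v\in\mathcal R_\ell\}|\bigr)=(1+o(1))\,\frac{p\rho_\ell A_2}{1-p\rho_\ell A_1}\,q_\ell n.$$ 3. A.a.s. $|\{(u,v)\in E(G_n):\mathcal R(u)\ne\mathcal R(v)\}|=o(n)$. -/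

import Mathlib

open MeasureTheory Filter Topology Set

namespace SPA

/-- The torus obtained from the unit hypercube `[0,1)^m` by identifying opposite faces. Its
`volume` is the Lebesgue (Haar) probability measure. -/
abbrev Torus (m : ℕ) : Type := Fin m → UnitAddCircle

/-- A metric on the torus that is equivalent to the Euclidean torus metric, i.e. induces the same
topology (the torus being compact Hausdorff, a metric does so as soon as it is continuous), and for
which balls of any prescribed volume around any point exist. -/
structure TorusMetric (m : ℕ) where
  dist : Torus m → Torus m → ℝ
  dist_eq_zero_iff : ∀ x y, dist x y = 0 ↔ x = y
  dist_comm : ∀ x y, dist x y = dist y x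
  dist_triangle : ∀ x y z, dist x z ≤ dist x y + dist y z
  continuous_dist : Continuous (fun z : Torus m × Torus m => dist z.1 z.2)
  exists_ball : ∀ (x : Torus m) (a : ℝ), 0 < a → a < 1 →
    ∃ r : ℝ, volume.real {y | dist x y ≤ r} = a

noncomputable section

/-- The radius of the ball of volume `a` centred at `x`, for `0 < a < 1`. -/
def TorusMetric.radius {m : ℕ} (d : TorusMetric m) (x : Torus m) (a : ℝ) : ℝ :=
  sInf {r : ℝ | a ≤ volume.real {y | d.dist x y ≤ r}}

/-- The ball centred at `x` with total volume `a`; it is the whole space if `1 ≤ a`. -/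
def TorusMetric.ballOfVolume {m : ℕ} (d : TorusMetric m) (x : Torus m) (a : ℝ) :
    Set (Torus m) :=
  {y | 1 ≤ a ∨ d.dist x y ≤ d.radius x a}

/-- The hypercube `I_{ℓ_1} × ⋯ × I_{ℓ_m}` with `I_j = [j/k, (j+1)/k)`, as a subset of the torus. -/
def region {m k : ℕ} (ℓ : Fin m → Fin k) : Set (Torus m) :=
  Set.univ.pi fun i =>
    (fun y : ℝ => (y : UnitAddCircle)) '' Set.Ico (((ℓ i : ℕ) : ℝ) / k) ((((ℓ i : ℕ) : ℝ) + 1) / k)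

/-- The parameters of the inhomogeneous SPA model with a locally constant density: `ρ ℓ` is the
density of the hypercube `region ℓ`. -/
structure Model where
  m : ℕ
  m_pos : 0 < m
  metric : TorusMetric m
  k : ℕ
  k_pos : 0 < k
  ρ : (Fin m → Fin k) → ℝ
  ρ_nonneg : ∀ ℓ, 0 ≤ ρ ℓ
  sum_ρ : ∑ ℓ, ρ ℓ * ((k : ℝ) ^ m)⁻¹ = 1
  A₁ : ℝ
  A₂ : ℝ
  p : ℝ
  A₁_pos : 0 < A₁
  A₂_pos : 0 < A₂
  p_pos : 0 < p
  p_lt_one : p < 1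
  subcritical : ∀ ℓ, p * A₁ * ρ ℓ < 1

namespace Model


variable (M : Model)

/-- Labels of the `k^m` regions. -/
abbrev Label : Type := Fin M.m → Fin M.k

/-- `q_ℓ = ρ_ℓ k^{-m}`. -/
def q (ℓ : M.Label) : ℝ := M.ρ ℓ * ((M.k : ℝ) ^ M.m)⁻¹

/-- The locally constant density function on the torus. -/
def density (x : Torus M.m) : ℝ :=
  ∑ ℓ : M.Label, (region ℓ).indicator (fun _ => M.ρ ℓ) x

/-- The law of the position of a node. -/
def nodeLaw : Measure (Torus M.m) :=
  volume.withDensity fun x => ENNReal.ofReal (M.density x)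

/-- The law of a coin that shows `true` with probability `p`. -/
def coinLaw : Measure Bool :=
  ENNReal.ofReal M.p • Measure.dirac true + ENNReal.ofReal (1 - M.p) • Measure.dirac false

/-- A sample: the positions of the nodes `v_t`, and for each pair `(t, i)` the coin that decides
whether `v_t` links to `v_i` if it falls in the sphere of influence of `v_i`. -/
abbrev Sample : Type := (ℕ → Torus M.m) × (ℕ × ℕ → Bool)

/-- The probability measure of the model: all positions and all coins are independent. -/
def law : Measure M.Sample :=
  (Measure.infinitePi fun _ : ℕ => M.nodeLaw).prod (Measure.infinitePi fun _ : ℕ × ℕ => M.coinLaw)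

/-- The in-degree of node `i` in a set of directed links. -/
def inDeg (E : Finset (ℕ × ℕ)) (i : ℕ) : ℕ := (E.filter fun e => e.2 = i).card

/-- The sphere of influence at time `t` of a node located at `x` that has in-degree `j`: the ball
centred at `x` of volume `(A₁ j + A₂) / t`. -/
def sphere (x : Torus M.m) (j t : ℕ) : Set (Torus M.m) :=
  M.metric.ballOfVolume x ((M.A₁ * j + M.A₂) / t)

open Classical in
/-- The links of the graph `G_t` on the nodes `v_1, …, v_t`; the node `v_i` is represented by its
index `i`, and the link `(v_s, v_i)` by `(s, i)`. -/
def edges (ω : M.Sample) : ℕ → Finset (ℕ × ℕ)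
  | 0 => ∅
  | t + 1 => edges ω t ∪
      ((Finset.Icc 1 t).filter fun i =>
        ω.1 (t + 1) ∈ M.sphere (ω.1 i) (inDeg (edges ω t) i) t ∧ ω.2 (t + 1, i) = true).image
        fun i => (t + 1, i)

open Classical in
/-- The number of nodes of `G_n` in the region `ℓ`. -/
def nodeCount (ω : M.Sample) (n : ℕ) (ℓ : M.Label) : ℕ :=
  ((Finset.Icc 1 n).filter fun i => ω.1 i ∈ region ℓ).card

open Classical in
/-- The number of links of `G_n` with both endpoints in the region `ℓ`. -/
def innerEdgeCount (ω : M.Sample) (n : ℕ) (ℓ : M.Label) : ℕ :=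
  ((M.edges ω n).filter fun e => ω.1 e.1 ∈ region ℓ ∧ ω.1 e.2 ∈ region ℓ).card

open Classical in
/-- The number of links of `G_n` whose endpoints are not in a common region. -/
def crossingEdgeCount (ω : M.Sample) (n : ℕ) : ℕ :=
  ((M.edges ω n).filter fun e =>
    ¬ ∃ ℓ : M.Label, ω.1 e.1 ∈ region ℓ ∧ ω.1 e.2 ∈ region ℓ).card

/-- The events `E n` hold asymptotically almost surely. -/
def AAS (E : ℕ → Set M.Sample) : Prop :=
  Tendsto (fun n => M.law (E n)) atTop (𝓝 1)

end Model

end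

end SPA

namespace SPA

noncomputable section

theorem exists_real_Iic_eq (ν : Measure ℝ) [IsProbabilityMeasure ν]
    (h0 : ∀ r, ν {r} = 0) (a : ℝ) (ha0 : 0 < a) (ha1 : a < 1) : ∃ r, ν.real (Set.Iic r) = a := by
  have hc : Continuous (ProbabilityTheory.cdf ν) := by
    rw [continuous_iff_continuousAt]
    intro r
    rw [(ProbabilityTheory.monotone_cdf ν).continuousAt_iff_leftLim_eq_rightLim,
      StieltjesFunction.rightLim_eq]
    have h := StieltjesFunction.measure_singleton (ProbabilityTheory.cdf ν) r
    rw [ProbabilityTheory.measure_cdf, h0] at h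
    have h2 := ENNReal.ofReal_eq_zero.1 h.symm
    have h3 := (ProbabilityTheory.monotone_cdf ν).leftLim_le (le_refl r)
    linarith
  have e0 : ∃ r, ProbabilityTheory.cdf ν r ≤ a :=
    (((ProbabilityTheory.tendsto_cdf_atBot ν).eventually (gt_mem_nhds ha0)).exists).imp
      fun _ h => le_of_lt h
  have e1 : ∃ r, a ≤ ProbabilityTheory.cdf ν r :=
    (((ProbabilityTheory.tendsto_cdf_atTop ν).eventually (lt_mem_nhds ha1)).exists).imp
      fun _ h => le_of_lt h
  obtain ⟨r, hr⟩ := mem_range_of_exists_le_of_exists_ge hc e0 e1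
  exact ⟨r, by rw [← ProbabilityTheory.cdf_eq_real]; exact hr⟩

theorem finite_norm_eq (x : UnitAddCircle) (c : ℝ) :
    {a : UnitAddCircle | ‖x - a‖ ^ 2 = c}.Finite := by
  have key : ∀ u : UnitAddCircle, u = ((‖u‖ : ℝ) : UnitAddCircle) ∨
      u = ((-‖u‖ : ℝ) : UnitAddCircle) := by
    intro u
    induction u using QuotientAddGroup.induction_on with
    | H t =>
      have hz : ((t - round t : ℝ) : UnitAddCircle) = (t : UnitAddCircle) := by
        rw [← sub_eq_zero, ← AddCircle.coe_sub, AddCircle.coe_eq_zero_iff]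
        exact ⟨-round t, by simp⟩
      rw [show (QuotientAddGroup.mk t : UnitAddCircle) = (t : UnitAddCircle) from rfl,
        UnitAddCircle.norm_eq]
      rcases abs_choice (t - round t) with h | h <;> rw [h]
      · left; exact hz.symm
      · right; rw [neg_neg]; exact hz.symm
  refine (Set.toFinite {x - ((Real.sqrt c : ℝ) : UnitAddCircle),
    x - ((-Real.sqrt c : ℝ) : UnitAddCircle)}).subset ?_
  intro a ha
  have hs : ‖x - a‖ = Real.sqrt c := by
    rw [← (show ‖x - a‖ ^ 2 = c from ha), Real.sqrt_sq (norm_nonneg _)]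
  have h := key (x - a)
  rw [hs] at h
  rcases h with h | h
  · left; rw [← h]; abel
  · right; rw [Set.mem_singleton_iff, ← h]; abel

theorem volume_sphere_eq_zero {m : ℕ} (hm : 0 < m) (x : Torus m) (c : ℝ) :
    volume {y : Torus m | ∑ i, ‖x i - y i‖ ^ 2 = c} = 0 := by
  obtain ⟨n, rfl⟩ : ∃ n, m = n + 1 := ⟨m - 1, by omega⟩
  have hmeas : MeasurableSet {y : Torus (n + 1) | ∑ i, ‖x i - y i‖ ^ 2 = c} :=
    (isClosed_eq (by fun_prop) continuous_const).measurableSet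
  have mp := (volume_preserving_piFinSuccAbove (fun _ : Fin (n + 1) => UnitAddCircle) 0).symm
  rw [← mp.measure_preimage hmeas.nullMeasurableSet, Measure.volume_eq_prod,
    Measure.prod_apply_symm (mp.measurable hmeas)]
  refine (lintegral_congr fun b => ?_).trans lintegral_zero
  have hpt : ∀ u : UnitAddCircle, volume {u} = 0 := fun u => by
    rw [← Metric.closedBall_zero (x := u), AddCircle.volume_closedBall]; simp
  have hfin := finite_norm_eq (x 0) (c - ∑ i : Fin n, ‖x i.succ - b i‖ ^ 2)
  refine measure_mono_null ?_ ((measure_biUnion_null_iff hfin.countable).2 fun u _ => hpt u)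
  rw [Set.biUnion_of_singleton]
  intro a ha
  have h : ∑ i, ‖x i - (Fin.insertNth (0 : Fin (n + 1)) a b : Torus (n + 1)) i‖ ^ 2 = c := ha
  rw [Fin.sum_univ_succ] at h
  simp only [Fin.insertNth_zero', Fin.cons_zero, Fin.cons_succ] at h
  exact eq_sub_of_add_eq h

/-- The torus metric derived from the Euclidean norm. -/
def euclideanMetric (m : ℕ) (hm : 0 < m) : TorusMetric m where
  dist x y := Real.sqrt (∑ i, ‖x i - y i‖ ^ 2)
  dist_eq_zero_iff x y := by
    rw [Real.sqrt_eq_zero (by positivity), Finset.sum_eq_zero_iff_of_nonneg (by intros; positivity)]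
    simp [sub_eq_zero, funext_iff]
  dist_comm x y := by simp only [norm_sub_rev]
  dist_triangle x y z := by
    have h := norm_add_le (WithLp.toLp 2 (fun i => ‖x i - y i‖) : EuclideanSpace ℝ (Fin m))
      (WithLp.toLp 2 (fun i => ‖y i - z i‖))
    simp only [EuclideanSpace.norm_eq, PiLp.add_apply, Real.norm_eq_abs, sq_abs] at h
    refine le_trans (Real.sqrt_le_sqrt (Finset.sum_le_sum fun i _ => ?_)) h
    gcongr
    simpa using norm_add_le (x i - y i) (y i - z i)
  continuous_dist := by fun_prop
  exists_ball x a h0 h1 := by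
    have hf : Continuous fun y : Torus m => Real.sqrt (∑ i, ‖x i - y i‖ ^ 2) := by fun_prop
    have : IsProbabilityMeasure (volume : Measure (Torus m)) := ⟨by
      rw [← Set.pi_univ Set.univ, volume_pi_pi]; simp⟩
    have : IsProbabilityMeasure (volume.map fun y : Torus m =>
        Real.sqrt (∑ i, ‖x i - y i‖ ^ 2)) := Measure.isProbabilityMeasure_map hf.aemeasurable
    obtain ⟨r, hr⟩ := exists_real_Iic_eq (volume.map fun y : Torus m =>
        Real.sqrt (∑ i, ‖x i - y i‖ ^ 2)) (fun r => by
      rw [Measure.map_apply hf.measurable (measurableSet_singleton r)]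
      refine measure_mono_null (fun y hy => ?_) (volume_sphere_eq_zero hm x (r ^ 2))
      have hy' : Real.sqrt (∑ i, ‖x i - y i‖ ^ 2) = r := hy
      rw [Set.mem_ofPred_eq, ← hy', Real.sq_sqrt (by positivity)]) a h0 h1
    refine ⟨r, ?_⟩
    rw [← hr, map_measureReal_apply hf.measurable measurableSet_Iic]
    rfl

theorem coe_injOn : Set.InjOn (fun y : ℝ => (y : UnitAddCircle)) (Set.Ico 0 1) := by
  intro a ha b hb h
  have := (AddCircle.coe_eq_coe_iff_of_mem_Ico (p := (1:ℝ)) (a := 0) (by simpa using ha) (by simpa using hb)).1 h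
  exact this

theorem measurableSet_arc (a b : ℝ) (h0 : 0 ≤ a) (h1 : b ≤ 1) :
    MeasurableSet ((fun y : ℝ => (y : UnitAddCircle)) '' Set.Ico a b) :=
  measurableSet_Ico.image_of_measurable_injOn AddCircle.measurable_mk'
    (coe_injOn.mono (Set.Ico_subset_Ico h0 h1))

theorem volume_arc (a b : ℝ) (h0 : 0 ≤ a) (h1 : b ≤ 1) :
    volume ((fun y : ℝ => (y : UnitAddCircle)) '' Set.Ico a b) = ENNReal.ofReal (b - a) := by
  rw [AddCircle.add_projection_respects_measure 1 0 (measurableSet_arc a b h0 h1)]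
  apply le_antisymm
  · calc _ ≤ volume (Set.Icc a b ∪ {1}) := measure_mono ?_
      _ ≤ volume (Set.Icc a b) + volume {(1 : ℝ)} := measure_union_le _ _
      _ = _ := by simp
    rintro t ⟨⟨s, hs, hst⟩, ht0, ht1⟩
    rw [zero_add] at ht1
    rcases ht1.eq_or_lt with h | h
    · exact Or.inr h
    · left
      have : s = t := coe_injOn ⟨h0.trans hs.1, hs.2.trans_le h1⟩ ⟨ht0.le, h⟩ hst
      exact this ▸ ⟨hs.1, hs.2.le⟩
  · rw [← Real.volume_Ioo]
    refine measure_mono fun t ht => ⟨⟨t, ⟨ht.1.le, ht.2⟩, rfl⟩, h0.trans_lt ht.1, ?_⟩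
    rw [zero_add]
    exact (ht.2.trans_le h1).le

theorem label_bounds {k : ℕ} (j : Fin k) :
    (0 : ℝ) ≤ ((j : ℕ) : ℝ) / k ∧ (((j : ℕ) : ℝ) + 1) / k ≤ 1 := by
  have hk : (0 : ℝ) < k := by exact_mod_cast j.pos
  refine ⟨by positivity, ?_⟩
  rw [div_le_one hk]
  exact_mod_cast j.isLt

theorem measurableSet_region {m k : ℕ} (ℓ : Fin m → Fin k) : MeasurableSet (region ℓ) :=
  MeasurableSet.univ_pi fun i => measurableSet_arc _ _ (label_bounds (ℓ i)).1 (label_bounds (ℓ i)).2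

theorem volume_region {m k : ℕ} (ℓ : Fin m → Fin k) :
    volume (region ℓ) = ENNReal.ofReal (((k : ℝ) ^ m)⁻¹) := by
  rw [region, volume_pi_pi]
  simp_rw [fun i => volume_arc _ _ (label_bounds (ℓ i)).1 (label_bounds (ℓ i)).2]
  rw [← ENNReal.ofReal_prod_of_nonneg]
  · simp [← sub_div]
  · intro i _
    rw [← sub_div]; simp

theorem existsUnique_region {m k : ℕ} (hk : 0 < k) (x : Torus m) :
    ∃! ℓ : Fin m → Fin k, x ∈ region ℓ := by
  have hk' : (0 : ℝ) < k := by exact_mod_cast hk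
  have h : ∀ u : UnitAddCircle, ∃! j : Fin k, u ∈ (fun y : ℝ => (y : UnitAddCircle)) ''
      Set.Ico (((j : ℕ) : ℝ) / k) ((((j : ℕ) : ℝ) + 1) / k) := by
    intro u
    obtain ⟨y, hy, rfl⟩ : ∃ y ∈ Set.Ico (0 : ℝ) 1, (y : UnitAddCircle) = u := by
      have := AddCircle.coe_image_Ico_eq (1 : ℝ) 0
      rw [zero_add] at this
      exact (Set.ext_iff.1 this u).2 trivial
    have hlt : ⌊(k : ℝ) * y⌋₊ < k := by
      rw [Nat.floor_lt (mul_nonneg hk'.le hy.1)]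
      nlinarith [hy.2]
    refine ⟨⟨_, hlt⟩, ⟨y, ⟨?_, ?_⟩, rfl⟩, ?_⟩
    · rw [div_le_iff₀ hk', mul_comm y]
      exact Nat.floor_le (mul_nonneg hk'.le hy.1)
    · rw [lt_div_iff₀ hk', mul_comm y]
      exact Nat.lt_floor_add_one _
    · rintro j ⟨z, hz, hzy⟩
      have hzy' : z = y := coe_injOn ⟨(label_bounds j).1.trans hz.1,
        hz.2.trans_le (label_bounds j).2⟩ hy hzy
      subst hzy'
      apply Fin.ext
      symm
      rw [Nat.floor_eq_iff (mul_nonneg hk'.le hy.1)]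
      have h1 := hz.1
      have h2 := hz.2
      rw [div_le_iff₀ hk'] at h1
      rw [lt_div_iff₀ hk'] at h2
      constructor <;> linarith
  choose f hf hu using h
  refine ⟨fun i => f (x i), fun i _ => hf (x i), fun ℓ hℓ => funext fun i => hu _ _ (hℓ i trivial)⟩

namespace Model

variable (M : Model)

instance : IsProbabilityMeasure M.coinLaw := ⟨by
  simp only [coinLaw, Measure.add_apply, Measure.smul_apply, measure_univ, smul_eq_mul, mul_one]
  rw [← ENNReal.ofReal_add M.p_pos.le (by linarith [M.p_lt_one])]
  simp⟩

instance : IsProbabilityMeasure M.nodeLaw := ⟨by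
  rw [nodeLaw, withDensity_apply _ MeasurableSet.univ, Measure.restrict_univ]
  have h : ∀ x, ENNReal.ofReal (M.density x) =
      ∑ ℓ : M.Label, (region ℓ).indicator (fun _ => ENNReal.ofReal (M.ρ ℓ)) x := by
    intro x
    rw [density, ENNReal.ofReal_sum_of_nonneg
      (fun ℓ _ => Set.indicator_nonneg (fun _ _ => M.ρ_nonneg ℓ) x)]
    refine Finset.sum_congr rfl fun ℓ _ => ?_
    by_cases hx : x ∈ region ℓ <;> simp [hx]
  simp_rw [h]
  rw [lintegral_finsetSum _
    (fun ℓ _ => measurable_const.indicator (measurableSet_region ℓ))]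
  simp_rw [lintegral_indicator_const (measurableSet_region _), volume_region,
    ← ENNReal.ofReal_mul (M.ρ_nonneg _)]
  rw [← ENNReal.ofReal_sum_of_nonneg
    (fun ℓ _ => mul_nonneg (M.ρ_nonneg ℓ) (by positivity)), M.sum_ρ, ENNReal.ofReal_one]⟩

instance : IsProbabilityMeasure M.law := by unfold law; infer_instance

end Model
end
end SPA

namespace SPA

/-! The node counts follow from the strong law of large numbers. The link counts rest on recursions
for expectations. Given the past, node `t + 1` links to a node of weight `w = A₁ deg⁻ + A₂` with
probability `p` times the `nodeLaw` measure of a ball of volume `a = min 1 (w / t)`. If the ball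
stayed in its region ℓ, this would be `p * ρ ℓ * a`. The expected number `e t` of inner links would
then grow by about `p * ρ ℓ * (A₁ * e t / t + A₂ * q ℓ)`, and `e t / t` would tend to the fixed
point of this linear recursion, which is attracting because `p * A₁ * ρ ℓ < 1`.

The content is therefore that spheres of influence rarely leave their region. The leaked volume of a
ball of volume at most `a` is bounded by `a` if the centre lies in `nearBoundary j`, plus `(j + 1) *
a ^ 2` in any case (`outerVolume_le_indicator_add`). Summed over the nodes, the first term has
expectation at most a constant times the measure of `nearBoundary j`, since the expected weight of
the nodes in a set `B` is at most a constant times `nodeLaw B * t` (`exists_meanWeight_le`). This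
measure is small for large `j`, as almost every point is interior to its region. The second term
vanishes as `t → ∞`, because the expected sum of squared weights is o(t²) (`tendsto_meanSq_div`).
Hence the leaked volume tends to 0 in mean (`tendsto_meanOuterVolume`), crossing links number o(n)
in mean, and Markov's inequality gives the third claim.

All limits come from one lemma on recursions, `tendsto_zero_of_recursion`; the conditioning step is
`integral_link`. -/

instance (m : ℕ) : IsProbabilityMeasure (volume : Measure (Torus m)) := ⟨by
  rw [← Set.pi_univ Set.univ, volume_pi_pi]; simp⟩

/-! ### Balls of prescribed volume -/

namespace TorusMetric

variable {m : ℕ} (d : TorusMetric m)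

theorem dist_nonneg (x y : Torus m) : 0 ≤ d.dist x y := by
  have h := d.dist_triangle x y x
  rw [(d.dist_eq_zero_iff x x).2 rfl, d.dist_comm y x] at h
  linarith

theorem isClosed_ball (x : Torus m) (r : ℝ) : IsClosed {y | d.dist x y ≤ r} :=
  isClosed_le (d.continuous_dist.comp (Continuous.prodMk_right x)) continuous_const

theorem radius_le_of_le {x : Torus m} {a r : ℝ} (ha : 0 < a)
    (h : a ≤ volume.real {y | d.dist x y ≤ r}) : d.radius x a ≤ r := by
  refine csInf_le ⟨0, fun s hs => ?_⟩ h
  by_contra! hs0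
  have he : {y | d.dist x y ≤ s} = ∅ :=
    Set.eq_empty_of_forall_notMem fun y hy => absurd (d.dist_nonneg x y) (not_le.2 (hy.trans_lt hs0))
  have hs' : a ≤ volume.real {y | d.dist x y ≤ s} := hs
  rw [he, measureReal_empty] at hs'
  linarith

/-- The closed ball of radius R is the decreasing intersection of the balls of radii r > R, each of
volume at least `a`; continuity of the measure from above passes to the limit. -/
theorem le_volume_ball_radius {x : Torus m} {a : ℝ} (h0 : 0 < a) (h1 : a < 1) :
    a ≤ volume.real {y | d.dist x y ≤ d.radius x a} := by
  set R := d.radius x a with hR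
  have hne : {r : ℝ | a ≤ volume.real {y | d.dist x y ≤ r}}.Nonempty :=
    (d.exists_ball x a h0 h1).imp fun r hr => hr.ge
  have hgt : ∀ r, R < r → ENNReal.ofReal a ≤ volume {y | d.dist x y ≤ r} := by
    intro r hr
    obtain ⟨s, hs, hsr⟩ := exists_lt_of_csInf_lt hne hr
    refine (ENNReal.ofReal_le_iff_le_toReal (measure_ne_top _ _)).2 (le_trans hs ?_)
    exact measureReal_mono fun y hy => le_trans hy hsr.le
  have ht := tendsto_measure_biInter_gt (μ := (volume : Measure (Torus m))) (a := R)
    (s := fun r => {y | d.dist x y ≤ r})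
    (fun r _ => (d.isClosed_ball x r).measurableSet.nullMeasurableSet)
    (fun i j _ hij y hy => le_trans hy hij) ⟨R + 1, by linarith, measure_ne_top _ _⟩
  have hI : (⋂ r, ⋂ (_ : r > R), {y | d.dist x y ≤ r}) = {y | d.dist x y ≤ R} := by
    ext y
    simp only [Set.mem_iInter]
    exact ⟨fun h => le_of_forall_gt_imp_ge_of_dense h, fun h r hr => le_trans h hr.le⟩
  rw [hI] at ht
  refine (ENNReal.ofReal_le_iff_le_toReal (measure_ne_top _ _)).1 (ge_of_tendsto ht ?_)
  filter_upwards [self_mem_nhdsWithin] with r hr using hgt r hr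

/-- The infimum defining the radius is attained. This turns sublevel sets of the radius into
conditions on volumes of sections, whence its measurability in the centre. -/
theorem radius_le_iff {x : Torus m} {a r : ℝ} (h0 : 0 < a) (h1 : a < 1) :
    d.radius x a ≤ r ↔ a ≤ volume.real {y | d.dist x y ≤ r} :=
  ⟨fun h => (d.le_volume_ball_radius h0 h1).trans (measureReal_mono fun _ hy => le_trans hy h),
    d.radius_le_of_le h0⟩

theorem ballOfVolume_of_lt_one {x : Torus m} {a : ℝ} (h1 : a < 1) :
    d.ballOfVolume x a = {y | d.dist x y ≤ d.radius x a} :=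
  Set.ext fun _ => or_iff_right (not_le.2 h1)

theorem ballOfVolume_of_one_le {x : Torus m} {a : ℝ} (h1 : 1 ≤ a) :
    d.ballOfVolume x a = univ :=
  Set.eq_univ_of_forall fun _ => Or.inl h1

theorem volume_ballOfVolume (x : Torus m) {a : ℝ} (h0 : 0 < a) :
    volume.real (d.ballOfVolume x a) = min 1 a := by
  rcases le_or_gt 1 a with h1 | h1
  · rw [d.ballOfVolume_of_one_le h1, min_eq_left h1, probReal_univ]
  · rw [d.ballOfVolume_of_lt_one h1, min_eq_right h1.le]
    refine le_antisymm ?_ (d.le_volume_ball_radius h0 h1)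
    -- Some ball has volume exactly `a`, and the ball of minimal radius is contained in it.
    obtain ⟨r, hr⟩ := d.exists_ball x a h0 h1
    exact (measureReal_mono fun y hy => le_trans hy (d.radius_le_of_le h0 hr.ge)).trans_eq hr

theorem ballOfVolume_mono (x : Torus m) {a b : ℝ} (h0 : 0 < a) (hab : a ≤ b) :
    d.ballOfVolume x a ⊆ d.ballOfVolume x b := by
  rcases le_or_gt 1 b with h1 | h1
  · rw [d.ballOfVolume_of_one_le h1]; exact subset_univ _
  · rw [d.ballOfVolume_of_lt_one h1, d.ballOfVolume_of_lt_one (hab.trans_lt h1)]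
    exact fun y hy => le_trans hy (d.radius_le_of_le h0
      (hab.trans (d.le_volume_ball_radius (h0.trans_le hab) h1)))

theorem measurable_radius {a : ℝ} (h0 : 0 < a) (h1 : a < 1) :
    Measurable fun x : Torus m => d.radius x a := by
  refine measurable_of_Iic fun r => ?_
  have : (fun x : Torus m => d.radius x a) ⁻¹' Iic r =
      {x | a ≤ (volume (Prod.mk x ⁻¹' {z : Torus m × Torus m | d.dist z.1 z.2 ≤ r})).toReal} :=
    Set.ext fun x => d.radius_le_iff h0 h1
  rw [this]
  refine measurableSet_le measurable_const (Measurable.ennreal_toReal ?_)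
  exact measurable_measure_prodMk_left (isClosed_le d.continuous_dist continuous_const).measurableSet

theorem measurableSet_ballOfVolume {a : ℝ} (h0 : 0 < a) :
    MeasurableSet {z : Torus m × Torus m | z.2 ∈ d.ballOfVolume z.1 a} := by
  rcases le_or_gt 1 a with h1 | h1
  · simp [d.ballOfVolume_of_one_le h1]
  · simp only [d.ballOfVolume_of_lt_one h1]
    exact measurableSet_le d.continuous_dist.measurable
      ((d.measurable_radius h0 h1).comp measurable_fst)

/-- By compactness the distance from `x` to the complement of an open neighbourhood is bounded
below, so some ball of radius δ > 0 fits inside. It has positive volume, hence contains every ball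
of smaller volume about `x`. -/
theorem exists_ballOfVolume_subset {x : Torus m} {U : Set (Torus m)} (hU : U ∈ 𝓝 x) :
    ∃ j : ℕ, d.ballOfVolume x (1 / ((j : ℝ) + 1)) ⊆ U := by
  obtain ⟨V, hVU, hV, hxV⟩ := mem_nhds_iff.1 hU
  have hc : Continuous fun y => d.dist x y := d.continuous_dist.comp (Continuous.prodMk_right x)
  obtain ⟨δ, hδ, hδV⟩ : ∃ δ > 0, {y | d.dist x y ≤ δ} ⊆ V := by
    rcases (Vᶜ).eq_empty_or_nonempty with he | hne
    · exact ⟨1, one_pos, by rw [Set.compl_empty_iff.1 he]; exact subset_univ _⟩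
    · obtain ⟨z, hz, hmin⟩ := hV.isClosed_compl.isCompact.exists_isMinOn hne hc.continuousOn
      have hpos : 0 < d.dist x z := lt_of_le_of_ne (d.dist_nonneg x z) fun h =>
        hz (((d.dist_eq_zero_iff x z).1 h.symm) ▸ hxV)
      refine ⟨d.dist x z / 2, by linarith, fun y hy => ?_⟩
      by_contra hyV
      have h1 : d.dist x z ≤ d.dist x y := hmin hyV
      have h2 : d.dist x y ≤ d.dist x z / 2 := hy
      linarith
  have hvol : 0 < volume.real {y | d.dist x y ≤ δ} := by
    have hopen : IsOpen {y | d.dist x y < δ} := isOpen_lt hc continuous_const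
    have h := hopen.measure_pos (volume : Measure (Torus m))
      ⟨x, by rw [Set.mem_ofPred_eq, (d.dist_eq_zero_iff x x).2 rfl]; exact hδ⟩
    refine lt_of_lt_of_le (ENNReal.toReal_pos h.ne' (measure_ne_top _ _)) ?_
    exact measureReal_mono fun y (hy : d.dist x y < δ) => hy.le
  obtain ⟨j, hj⟩ := exists_nat_one_div_lt hvol
  refine ⟨j, fun y hy => hVU (hδV ?_)⟩
  rw [d.ballOfVolume_of_lt_one (hj.trans_le (by exact measureReal_le_one))] at hy
  exact le_trans hy (d.radius_le_of_le (by positivity) hj.le)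

end TorusMetric

/-! ### Regions, density, and the mass near region boundaries -/

theorem volume_hyperplane {m : ℕ} (i : Fin m) (c : UnitAddCircle) :
    volume {x : Torus m | x i = c} = 0 := by
  have : NullSingletonClass (volume : Measure UnitAddCircle) := ⟨fun u => by
    rw [← Metric.closedBall_zero (x := u), AddCircle.volume_closedBall]; simp⟩
  exact Measure.pi_hyperplane (fun _ : Fin m => (volume : Measure UnitAddCircle)) i c

/-- The arcs are half-open, so a point of a region can fail to be interior only if some coordinate
is a left endpoint j/k. These are finitely many null hyperplanes. -/
theorem ae_region_mem_nhds {m k : ℕ} :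
    ∀ᵐ x : Torus m, ∀ ℓ : Fin m → Fin k, x ∈ region ℓ → region ℓ ∈ 𝓝 x := by
  have h : ∀ᵐ x : Torus m, ∀ (i : Fin m) (j : Fin k),
      x i ≠ ((((j : ℕ) : ℝ) / k : ℝ) : UnitAddCircle) := by
    rw [ae_all_iff]; intro i
    rw [ae_all_iff]; intro j
    rw [ae_iff]
    simpa using volume_hyperplane i ((((j : ℕ) : ℝ) / k : ℝ) : UnitAddCircle)
  filter_upwards [h] with x hx ℓ hℓ
  refine set_pi_mem_nhds Set.finite_univ fun i _ => ?_
  obtain ⟨y, hy, hyx⟩ := hℓ i trivial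
  have hne : ((ℓ i : ℕ) : ℝ) / k ≠ y := by
    rintro rfl
    exact hx i (ℓ i) hyx.symm
  rw [← hyx]
  exact QuotientAddGroup.isOpenMap_coe.image_mem_nhds
    (Ico_mem_nhds (lt_of_le_of_ne hy.1 hne) hy.2)

namespace Model

variable (M : Model)

/-- As there are finitely many labels, subcriticality holds uniformly; `R` bounds the density for
spheres that meet several regions. -/
theorem exists_ρ_bound : ∃ R : ℝ, 0 ≤ R ∧ (∀ ℓ, M.ρ ℓ ≤ R) ∧ M.p * M.A₁ * R < 1 := by
  have : Nonempty (Fin M.k) := ⟨⟨0, M.k_pos⟩⟩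
  obtain ⟨ℓ, hℓ⟩ := Finite.exists_max M.ρ
  exact ⟨M.ρ ℓ, M.ρ_nonneg ℓ, hℓ, M.subcritical ℓ⟩

theorem density_eq {x : Torus M.m} {ℓ : M.Label} (hx : x ∈ region ℓ) : M.density x = M.ρ ℓ := by
  rw [density, Finset.sum_eq_single ℓ, Set.indicator_of_mem hx]
  · intro ℓ' _ hne
    exact Set.indicator_of_notMem (fun h => hne ((existsUnique_region M.k_pos x).unique h hx)) _
  · simp

theorem density_le {R : ℝ} (hR : ∀ ℓ, M.ρ ℓ ≤ R) (x : Torus M.m) : M.density x ≤ R := by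
  obtain ⟨ℓ, hℓ, -⟩ := existsUnique_region M.k_pos x
  rw [M.density_eq hℓ]; exact hR ℓ

theorem nodeLaw_real_le {R : ℝ} (h0 : 0 ≤ R) (hR : ∀ ℓ, M.ρ ℓ ≤ R) {A : Set (Torus M.m)}
    (hA : MeasurableSet A) : M.nodeLaw.real A ≤ R * volume.real A := by
  rw [Measure.real, Measure.real, ← ENNReal.toReal_ofReal h0, ← ENNReal.toReal_mul]
  refine ENNReal.toReal_mono (ENNReal.mul_ne_top ENNReal.ofReal_ne_top (measure_ne_top _ _)) ?_
  rw [nodeLaw, withDensity_apply _ hA, ← setLIntegral_const]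
  exact lintegral_mono fun x => ENNReal.ofReal_le_ofReal (M.density_le hR x)

theorem nodeLaw_real_of_subset {ℓ : M.Label} {A : Set (Torus M.m)}
    (hA : MeasurableSet A) (hAℓ : A ⊆ region ℓ) : M.nodeLaw.real A = M.ρ ℓ * volume.real A := by
  rw [Measure.real, Measure.real, nodeLaw, withDensity_apply _ hA,
    setLIntegral_congr_fun (g := fun _ => ENNReal.ofReal (M.ρ ℓ)) hA
      (fun x hx => by simp only [M.density_eq (hAℓ hx)]),
    setLIntegral_const, ENNReal.toReal_mul, ENNReal.toReal_ofReal (M.ρ_nonneg ℓ)]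

theorem nodeLaw_real_region (ℓ : M.Label) : M.nodeLaw.real (region ℓ) = M.q ℓ := by
  rw [M.nodeLaw_real_of_subset (measurableSet_region ℓ) subset_rfl, Measure.real, volume_region,
    ENNReal.toReal_ofReal (by positivity), q]

/-- Pairs of points that do not lie in a common region. -/
def crossing : Set (Torus M.m × Torus M.m) :=
  {z | ¬ ∃ ℓ : M.Label, z.1 ∈ region ℓ ∧ z.2 ∈ region ℓ}

theorem measurableSet_crossing : MeasurableSet M.crossing := by
  have : M.crossing = (⋃ ℓ : M.Label, region ℓ ×ˢ region ℓ)ᶜ := by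
    ext z; simp [crossing]
  rw [this]
  exact (MeasurableSet.iUnion fun ℓ =>
    (measurableSet_region ℓ).prod (measurableSet_region ℓ)).compl

/-- The volume of the part of the ball of volume `a` around `x` outside the region of `x`. -/
noncomputable def outerVolume (x : Torus M.m) (a : ℝ) : ℝ :=
  volume.real (M.metric.ballOfVolume x a ∩ Prod.mk x ⁻¹' M.crossing)

theorem measurable_outerVolume {a : ℝ} (ha : 0 < a) : Measurable fun x => M.outerVolume x a :=
  (measurable_measure_prodMk_left
    ((M.metric.measurableSet_ballOfVolume ha).inter M.measurableSet_crossing)).ennreal_toReal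

theorem outerVolume_mono (x : Torus M.m) {a b : ℝ} (h0 : 0 < a) (hab : a ≤ b) :
    M.outerVolume x a ≤ M.outerVolume x b :=
  measureReal_mono (inter_subset_inter_left _ (M.metric.ballOfVolume_mono x h0 hab))

theorem outerVolume_le (x : Torus M.m) {a : ℝ} (h0 : 0 < a) : M.outerVolume x a ≤ min 1 a :=
  (measureReal_mono inter_subset_left).trans_eq (M.metric.volume_ballOfVolume x h0)

/-- Points whose ball of volume `1 / (j + 1)` leaves their region substantially. -/
def nearBoundary (j : ℕ) : Set (Torus M.m) := {x | 0 < M.outerVolume x (1 / ((j : ℝ) + 1))}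

theorem measurableSet_nearBoundary (j : ℕ) : MeasurableSet (M.nearBoundary j) :=
  measurableSet_lt measurable_const (M.measurable_outerVolume (by positivity))

/-- The sets decrease in `j`, and a point in all of them has no small ball inside its region, so it
is not interior to it. Such points form a null set. -/
theorem tendsto_nodeLaw_nearBoundary :
    Tendsto (fun j => M.nodeLaw.real (M.nearBoundary j)) atTop (𝓝 0) := by
  have ht := tendsto_measure_iInter_atTop (μ := M.nodeLaw) (s := M.nearBoundary)
    (fun j => (M.measurableSet_nearBoundary j).nullMeasurableSet)
    (fun i j hij x hx => lt_of_lt_of_le hx (M.outerVolume_mono x (by positivity)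
      (one_div_le_one_div_of_le (by positivity) (by gcongr))))
    ⟨0, measure_ne_top _ _⟩
  have h0 : M.nodeLaw (⋂ j, M.nearBoundary j) = 0 := by
    refine withDensity_absolutelyContinuous _ _ ?_
    have hae := ae_region_mem_nhds (m := M.m) (k := M.k)
    refine measure_mono_null ?_ (ae_iff.1 hae)
    intro x hx hn
    obtain ⟨ℓ, hℓ, -⟩ := existsUnique_region M.k_pos x
    obtain ⟨j, hj⟩ := M.metric.exists_ballOfVolume_subset (hn ℓ hℓ)
    have hxj : 0 < M.outerVolume x (1 / ((j : ℝ) + 1)) := mem_iInter.1 hx j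
    have he : M.metric.ballOfVolume x (1 / ((j : ℝ) + 1)) ∩ Prod.mk x ⁻¹' M.crossing = ∅ :=
      Set.eq_empty_of_forall_notMem fun y hy => hy.2 ⟨ℓ, hℓ, hj hy.1⟩
    rw [outerVolume, he, measureReal_empty] at hxj
    exact lt_irrefl _ hxj
  rw [h0] at ht
  exact (ENNReal.tendsto_toReal ENNReal.zero_ne_top).comp ht

/-- Off `nearBoundary j`, a ball of volume at most 1/(j+1) leaks nothing; a larger one satisfies `a
≤ (j + 1) * a ^ 2`, so the trivial bound `a` suffices. -/
theorem outerVolume_le_indicator_add (x : Torus M.m) {a : ℝ} (h0 : 0 < a) (j : ℕ) :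
    M.outerVolume x a ≤ (M.nearBoundary j).indicator (fun _ => a) x + ((j : ℝ) + 1) * a ^ 2 := by
  have hj : (0 : ℝ) < (j : ℝ) + 1 := by positivity
  have hle := (M.outerVolume_le x h0).trans (min_le_right _ _)
  by_cases hx : x ∈ M.nearBoundary j
  · rw [Set.indicator_of_mem hx]
    have : 0 ≤ ((j : ℝ) + 1) * a ^ 2 := by positivity
    linarith
  · rw [Set.indicator_of_notMem hx, zero_add]
    rcases le_or_gt a (1 / ((j : ℝ) + 1)) with h | h
    · have h1 := M.outerVolume_mono x h0 h
      have h2 : M.outerVolume x (1 / ((j : ℝ) + 1)) ≤ 0 := not_lt.1 hx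
      have : 0 ≤ ((j : ℝ) + 1) * a ^ 2 := by positivity
      linarith
    · rw [div_lt_iff₀ hj] at h
      nlinarith

end Model
end SPA

/-! ### Invariance of the law under resampling -/

namespace SPA

/-- An infinite product measure is determined by its values on finite boxes, where overwriting
coordinate `a` only trades one factor for an independent copy. -/
theorem measurePreserving_update {ι X : Type*} [DecidableEq ι] [MeasurableSpace X]
    (μ : ι → Measure X) [∀ i, IsProbabilityMeasure (μ i)] (a : ι) :
    MeasurePreserving (fun z : (ι → X) × X => Function.update z.1 a z.2)
      ((Measure.infinitePi μ).prod (μ a)) (Measure.infinitePi μ) := by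
  have hm : Measurable (fun z : (ι → X) × X => Function.update z.1 a z.2) := by
    refine measurable_pi_lambda _ fun i => ?_
    by_cases h : i = a
    · subst h; simpa using measurable_snd
    · simpa [h] using (show Measurable fun z : (ι → X) × X => z.1 i by fun_prop)
  refine ⟨hm, Measure.eq_infinitePi _ fun s t ht => ?_⟩
  rw [Measure.map_apply hm (MeasurableSet.pi s.countable_toSet fun i _ => ht i)]
  have hpre : (fun z : (ι → X) × X => Function.update z.1 a z.2) ⁻¹' Set.pi s t =
      Set.pi (s.erase a : Finset ι) t ×ˢ (if a ∈ s then t a else univ) := by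
    ext ⟨x, y⟩
    simp only [mem_preimage, Set.mem_pi, Finset.mem_coe, mem_prod, Finset.mem_erase]
    constructor
    · intro h
      refine ⟨fun i hi => by simpa [hi.1] using h i hi.2, ?_⟩
      split_ifs with ha
      · simpa using h a ha
      · trivial
    · rintro ⟨h1, h2⟩ i hi
      by_cases hia : i = a
      · subst hia; simpa [hi] using h2
      · simpa [hia] using h1 i ⟨hia, hi⟩
  rw [hpre, Measure.prod_prod, Measure.infinitePi_pi _ fun i _ => ht i]
  split_ifs with ha
  · exact Finset.prod_erase_mul _ _ ha
  · rw [measure_univ, mul_one, Finset.erase_eq_of_notMem ha]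

theorem measurePreserving_prodProdProdComm {α β γ δ : Type*} [MeasurableSpace α]
    [MeasurableSpace β] [MeasurableSpace γ] [MeasurableSpace δ] (μ : Measure α) (ν : Measure β)
    (μ' : Measure γ) (ν' : Measure δ) [SFinite μ] [SFinite ν] [SFinite μ'] [SFinite ν'] :
    MeasurePreserving (fun z : (α × β) × (γ × δ) => ((z.1.1, z.2.1), (z.1.2, z.2.2)))
      ((μ.prod ν).prod (μ'.prod ν')) ((μ.prod μ').prod (ν.prod ν')) := by
  have h1 := measurePreserving_prodAssoc μ ν (μ'.prod ν')
  have h2 : MeasurePreserving (fun z : β × (γ × δ) => (z.2.1, (z.1, z.2.2)))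
      (ν.prod (μ'.prod ν')) (μ'.prod (ν.prod ν')) :=
    (measurePreserving_prodAssoc μ' ν ν').comp
      (((Measure.measurePreserving_swap (μ := ν) (ν := μ')).prod (MeasurePreserving.id ν')).comp
        (measurePreserving_prodAssoc ν μ' ν').symm)
  exact (measurePreserving_prodAssoc μ μ' (ν.prod ν')).symm.comp
    (((MeasurePreserving.id μ).prod h2).comp h1)

namespace Model

variable (M : Model)

/-- Replace the position of the node `s` and the coin of the pair `e`. -/
def resample (s : ℕ) (e : ℕ × ℕ) (z : M.Sample × (Torus M.m × Bool)) : M.Sample :=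
  (Function.update z.1.1 s z.2.1, Function.update z.1.2 e z.2.2)

theorem measurePreserving_resample (s : ℕ) (e : ℕ × ℕ) :
    MeasurePreserving (M.resample s e) (M.law.prod (M.nodeLaw.prod M.coinLaw)) M.law := by
  have h := (measurePreserving_update (fun _ : ℕ => M.nodeLaw) s).prod
    (measurePreserving_update (fun _ : ℕ × ℕ => M.coinLaw) e)
  refine h.comp (f := fun z : M.Sample × (Torus M.m × Bool) => ((z.1.1, z.2.1), (z.1.2, z.2.2))) ?_
  exact measurePreserving_prodProdProdComm _ _ _ _

theorem coinLaw_real_true : M.coinLaw.real {true} = M.p := by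
  simp [coinLaw, Measure.real, ENNReal.toReal_ofReal M.p_pos.le]

/-- The event that the node `t + 1` links to the node `i`. -/
def linkEvent (t i : ℕ) : Set M.Sample :=
  {ω | ω.1 (t + 1) ∈ M.sphere (ω.1 i) (inDeg (M.edges ω t) i) t ∧ ω.2 (t + 1, i) = true}

/-! ### Links, in-degrees and their expectations -/

theorem mem_edges {ω : M.Sample} {t : ℕ} {e : ℕ × ℕ} (he : e ∈ M.edges ω t) :
    1 ≤ e.2 ∧ e.2 < e.1 ∧ e.1 ≤ t := by
  induction t with
  | zero => simp [edges] at he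
  | succ t ih =>
    simp only [edges, Finset.mem_union, Finset.mem_image, Finset.mem_filter, Finset.mem_Icc] at he
    rcases he with he | ⟨i, ⟨hi, -⟩, rfl⟩
    · have := ih he; omega
    · simp; omega

open Classical in
theorem sum_edges_succ (ω : M.Sample) (t : ℕ) (φ : ℕ × ℕ → ℝ) :
    ∑ e ∈ M.edges ω (t + 1), φ e = ∑ e ∈ M.edges ω t, φ e +
      ∑ i ∈ Finset.Icc 1 t, (M.linkEvent t i).indicator (fun _ => φ (t + 1, i)) ω := by
  rw [edges, Finset.sum_union]
  · congr 1
    rw [Finset.sum_image (fun i _ j _ h => by simpa using h), Finset.sum_filter]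
    refine Finset.sum_congr rfl fun i _ => ?_
    simp only [Set.indicator_apply, linkEvent, Set.mem_ofPred_eq]
  · rw [Finset.disjoint_left]
    intro e he h
    have := (M.mem_edges he).2.2
    simp only [Finset.mem_image, Finset.mem_filter] at h
    obtain ⟨i, -, rfl⟩ := h
    simp at this

-- `G_t` is determined by the positions and coins of times up to `t`, so resampling the data of time
-- `t + 1` leaves it unchanged.
open Classical in
theorem edges_congr {ω ω' : M.Sample} {t : ℕ} (h1 : ∀ s ≤ t, ω.1 s = ω'.1 s)
    (h2 : ∀ s ≤ t, ∀ i, ω.2 (s, i) = ω'.2 (s, i)) : M.edges ω t = M.edges ω' t := by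
  induction t with
  | zero => rfl
  | succ t ih =>
    rw [edges, edges, ih (fun s hs => h1 s (by omega)) (fun s hs => h2 s (by omega))]
    congr 2
    convert Finset.filter_congr fun i hi => ?_ using 1
    rw [h1 (t + 1) le_rfl, h2 (t + 1) le_rfl, h1 i (by have := Finset.mem_Icc.1 hi; omega)]

theorem inDeg_eq_zero {ω : M.Sample} {t i : ℕ} (hi : t ≤ i) : inDeg (M.edges ω t) i = 0 := by
  rw [inDeg, Finset.card_eq_zero, Finset.filter_eq_empty_iff]
  intro e he h
  have := M.mem_edges he
  omega

theorem inDeg_cast (E : Finset (ℕ × ℕ)) (i : ℕ) :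
    (inDeg E i : ℝ) = ∑ e ∈ E, if e.2 = i then 1 else 0 := by
  rw [inDeg, Finset.card_filter]; push_cast; rfl

theorem inDeg_succ (ω : M.Sample) {t i : ℕ} (h1 : 1 ≤ i) (ht : i ≤ t) :
    (inDeg (M.edges ω (t + 1)) i : ℝ) = inDeg (M.edges ω t) i +
      (M.linkEvent t i).indicator (fun _ => 1) ω := by
  rw [inDeg_cast, sum_edges_succ, ← inDeg_cast, Finset.sum_eq_single i]
  · simp
  · intro j _ hj; simp [hj]
  · simp; omega

theorem measurableSet_sphere (j : ℕ) {t : ℕ} (ht : 1 ≤ t) :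
    MeasurableSet {z : Torus M.m × Torus M.m | z.2 ∈ M.sphere z.1 j t} :=
  M.metric.measurableSet_ballOfVolume (by
    have := M.A₁_pos; have := M.A₂_pos; have : (0 : ℝ) < t := by exact_mod_cast ht
    positivity)

/-- The sphere depends on the random in-degree, so the event is split into countably many pieces by
the value of the latter. -/
theorem measurableSet_linkEvent_of {t i : ℕ} (ht : 1 ≤ t)
    (h : Measurable fun ω : M.Sample => inDeg (M.edges ω t) i) :
    MeasurableSet (M.linkEvent t i) := by
  have : M.linkEvent t i = (⋃ j : ℕ, (fun ω : M.Sample => inDeg (M.edges ω t) i) ⁻¹' {j} ∩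
      (fun ω : M.Sample => (ω.1 i, ω.1 (t + 1))) ⁻¹' {z | z.2 ∈ M.sphere z.1 j t}) ∩
      (fun ω : M.Sample => ω.2 (t + 1, i)) ⁻¹' {true} := by
    ext ω; simp [linkEvent]
  rw [this]
  refine (MeasurableSet.iUnion fun j => (h (measurableSet_singleton j)).inter ?_).inter ?_
  · exact (show Measurable fun ω : M.Sample => (ω.1 i, ω.1 (t + 1)) by fun_prop)
      (M.measurableSet_sphere j ht)
  · exact (show Measurable fun ω : M.Sample => ω.2 (t + 1, i) by fun_prop)
      (measurableSet_singleton true)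

theorem measurable_inDeg (t i : ℕ) : Measurable fun ω : M.Sample => inDeg (M.edges ω t) i := by
  induction t with
  | zero => simp only [M.inDeg_eq_zero (Nat.zero_le i)]; exact measurable_const
  | succ t ih =>
    by_cases hi : 1 ≤ i ∧ i ≤ t
    · have hm := M.measurableSet_linkEvent_of (hi.1.trans hi.2) ih
      have : (fun ω : M.Sample => inDeg (M.edges ω (t + 1)) i) = fun ω =>
          inDeg (M.edges ω t) i + (M.linkEvent t i).indicator (fun _ => 1) ω := by
        funext ω
        have h := M.inDeg_succ ω hi.1 hi.2
        by_cases hω : ω ∈ M.linkEvent t i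
        · rw [Set.indicator_of_mem hω] at h ⊢; exact_mod_cast h
        · rw [Set.indicator_of_notMem hω] at h ⊢; exact_mod_cast h
      rw [this]
      exact ih.add (measurable_const.indicator hm)
    · have : ∀ ω : M.Sample, inDeg (M.edges ω (t + 1)) i = 0 := by
        intro ω
        rw [inDeg, Finset.card_eq_zero, Finset.filter_eq_empty_iff]
        intro e he h
        have := M.mem_edges he
        omega
      simp only [this]; exact measurable_const

theorem measurableSet_linkEvent {t i : ℕ} (ht : 1 ≤ t) : MeasurableSet (M.linkEvent t i) :=
  M.measurableSet_linkEvent_of ht (M.measurable_inDeg t i)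

theorem inDeg_le (ω : M.Sample) (t i : ℕ) : inDeg (M.edges ω t) i ≤ t := by
  have : inDeg (M.edges ω t) i ≤ (Finset.Icc 1 t).card := by
    refine Finset.card_le_card_of_injOn Prod.fst (fun e he => ?_) (fun e he e' he' h => ?_)
    · have := M.mem_edges (Finset.mem_filter.1 he).1
      simp; omega
    · have h1 := (Finset.mem_filter.1 he).2
      have h2 := (Finset.mem_filter.1 he').2
      exact Prod.ext h (h1.trans h2.symm)
  simpa using this

/-- The probability that a new node falls in the part of the sphere of influence of a node at `x`
with in-degree `j` that is selected by `T`. -/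
noncomputable def hitProb (T : Set (Torus M.m × Torus M.m)) (x : Torus M.m) (j t : ℕ) : ℝ :=
  M.nodeLaw.real (M.sphere x j t ∩ Prod.mk x ⁻¹' T)

theorem measurable_hitProb {T : Set (Torus M.m × Torus M.m)} (hT : MeasurableSet T) (j : ℕ) {t : ℕ}
    (ht : 1 ≤ t) : Measurable fun x => M.hitProb T x j t :=
  (measurable_measure_prodMk_left ((M.measurableSet_sphere j ht).inter hT)).ennreal_toReal

theorem measurable_inDeg_comp {f : ℕ → Torus M.m → ℝ} (hf : ∀ j, Measurable (f j)) (t i : ℕ) :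
    Measurable fun ω : M.Sample => f (inDeg (M.edges ω t) i) (ω.1 i) := by
  have hF : Measurable (fun z : ℕ × Torus M.m => f z.1 z.2) := measurable_from_prod_countable_right hf
  exact hF.comp ((M.measurable_inDeg t i).prodMk (by fun_prop))

theorem integrable_inDeg_comp {f : ℕ → Torus M.m → ℝ} (hf : ∀ j, Measurable (f j)) {t : ℕ} (i : ℕ)
    {C : ℝ} (hC : ∀ j ≤ t, ∀ x, |f j x| ≤ C) :
    Integrable (fun ω : M.Sample => f (inDeg (M.edges ω t) i) (ω.1 i)) M.law :=
  Integrable.of_bound (M.measurable_inDeg_comp hf t i).aestronglyMeasurable C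
    (ae_of_all _ fun ω => hC _ (M.inDeg_le ω t i) _)

theorem integrable_inDeg (h : ℕ → ℝ) (t i : ℕ) :
    Integrable (fun ω : M.Sample => h (inDeg (M.edges ω t) i)) M.law :=
  M.integrable_inDeg_comp (f := fun j _ => h j) (fun _ => measurable_const) i
    (C := ∑ j ∈ Finset.range (t + 1), |h j|) fun _ hj _ =>
      Finset.single_le_sum (f := fun j => |h j|) (fun _ _ => abs_nonneg _)
        (Finset.mem_range.2 (Nat.lt_succ_of_le hj))

/-- Conditioning on the past: a new node links to `i` with probability `p` times the measure of the
sphere of influence of `i`. -/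
theorem integral_link {T : Set (Torus M.m × Torus M.m)} (hT : MeasurableSet T) (h : ℕ → ℝ)
    {t i : ℕ} (hi : i ∈ Finset.Icc 1 t) :
    ∫ ω, (M.linkEvent t i ∩ {ω | (ω.1 i, ω.1 (t + 1)) ∈ T}).indicator
        (fun ω => h (inDeg (M.edges ω t) i)) ω ∂M.law =
      M.p * ∫ ω, h (inDeg (M.edges ω t) i) *
        M.hitProb T (ω.1 i) (inDeg (M.edges ω t) i) t ∂M.law := by
  obtain ⟨h1, hit⟩ := Finset.mem_Icc.1 hi
  have ht := h1.trans hit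
  have hmeas : MeasurableSet (M.linkEvent t i ∩ {ω | (ω.1 i, ω.1 (t + 1)) ∈ T}) :=
    (M.measurableSet_linkEvent ht).inter
      ((show Measurable fun ω : M.Sample => (ω.1 i, ω.1 (t + 1)) by fun_prop) hT)
  have hint := (M.integrable_inDeg h t i).indicator hmeas
  -- Redrawing the position of `v_{t+1}` and the coin of `(t + 1, i)` keeps the law; by Fubini, the
  -- inner integral over the fresh pair is the conditional expectation given the past.
  have hmp := M.measurePreserving_resample (t + 1) (t + 1, i)
  rw [← hmp.map_eq] at hint
  have hint' := (integrable_map_measure hint.aestronglyMeasurable hmp.aemeasurable).1 hint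
  rw [Function.comp_def] at hint'
  conv_lhs => rw [← hmp.map_eq]
  rw [integral_map hmp.aemeasurable hint.aestronglyMeasurable, integral_prod _ hint',
    ← integral_const_mul]
  refine integral_congr_ae (ae_of_all _ fun ω => ?_)
  have hedges : ∀ w, M.edges (M.resample (t + 1) (t + 1, i) (ω, w)) t = M.edges ω t := fun w =>
    M.edges_congr (fun s hs => Function.update_of_ne (by omega) _ _)
      (fun s hs j => Function.update_of_ne (by simp; omega) _ _)
  have hωi : ∀ w, (M.resample (t + 1) (t + 1, i) (ω, w)).1 i = ω.1 i := fun w =>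
    Function.update_of_ne (by omega) _ _
  -- With the past `ω` fixed, the event is a rectangle in the fresh position and coin, so its
  -- probability factors.
  have key : ∀ w : Torus M.m × Bool,
      (M.linkEvent t i ∩ {ω | (ω.1 i, ω.1 (t + 1)) ∈ T}).indicator
        (fun ω => h (inDeg (M.edges ω t) i)) (M.resample (t + 1) (t + 1, i) (ω, w)) =
      ((M.sphere (ω.1 i) (inDeg (M.edges ω t) i) t ∩ Prod.mk (ω.1 i) ⁻¹' T) ×ˢ {true}).indicator
        (fun _ => h (inDeg (M.edges ω t) i)) w := by
    intro w
    have hy : (M.resample (t + 1) (t + 1, i) (ω, w)).1 (t + 1) = w.1 := Function.update_self _ _ _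
    have hb : (M.resample (t + 1) (t + 1, i) (ω, w)).2 (t + 1, i) = w.2 :=
      Function.update_self _ _ _
    have hiff : M.resample (t + 1) (t + 1, i) (ω, w) ∈
        M.linkEvent t i ∩ {ω | (ω.1 i, ω.1 (t + 1)) ∈ T} ↔
        w ∈ (M.sphere (ω.1 i) (inDeg (M.edges ω t) i) t ∩ Prod.mk (ω.1 i) ⁻¹' T) ×ˢ {true} := by
      simp only [mem_inter_iff, linkEvent, Set.mem_ofPred_eq, hedges, hωi, hy, hb,
        mem_prod, mem_preimage, mem_singleton_iff]
      tauto
    by_cases hw : w ∈ (M.sphere (ω.1 i) (inDeg (M.edges ω t) i) t ∩ Prod.mk (ω.1 i) ⁻¹' T) ×ˢ {true}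
    · rw [Set.indicator_of_mem (hiff.2 hw), Set.indicator_of_mem hw, hedges]
    · rw [Set.indicator_of_notMem (mt hiff.1 hw), Set.indicator_of_notMem hw]
  have hS : MeasurableSet
      (M.sphere (ω.1 i) (inDeg (M.edges ω t) i) t ∩ Prod.mk (ω.1 i) ⁻¹' T) :=
    measurable_prodMk_left ((M.measurableSet_sphere _ ht).inter hT)
  simp only [key]
  rw [integral_indicator_const _ (hS.prod (measurableSet_singleton _)), measureReal_prod_prod,
    coinLaw_real_true, hitProb, smul_eq_mul]
  ring

/-- The number of links of `G_t` whose pair of endpoints (target first) lies in `T`. -/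
noncomputable def edgeCount (T : Set (Torus M.m × Torus M.m)) (ω : M.Sample) (t : ℕ) : ℝ :=
  ∑ e ∈ M.edges ω t, T.indicator (fun _ => 1) (ω.1 e.2, ω.1 e.1)

theorem edgeCount_zero (T : Set (Torus M.m × Torus M.m)) (ω : M.Sample) :
    M.edgeCount T ω 0 = 0 := by
  simp [edgeCount, edges]

theorem edgeCount_succ (T : Set (Torus M.m × Torus M.m)) (ω : M.Sample) (t : ℕ) :
    M.edgeCount T ω (t + 1) = M.edgeCount T ω t + ∑ i ∈ Finset.Icc 1 t,
      (M.linkEvent t i ∩ {ω | (ω.1 i, ω.1 (t + 1)) ∈ T}).indicator (fun _ => 1) ω := by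
  classical
  rw [edgeCount, sum_edges_succ, edgeCount]
  congr 1
  refine Finset.sum_congr rfl fun i _ => ?_
  rw [← Set.indicator_indicator]
  rfl

theorem integrable_edgeCount {T : Set (Torus M.m × Torus M.m)} (hT : MeasurableSet T) (t : ℕ) :
    Integrable (fun ω => M.edgeCount T ω t) M.law := by
  induction t with
  | zero => simp only [edgeCount_zero]; exact integrable_zero _ _ _
  | succ t ih =>
    simp only [edgeCount_succ]
    refine ih.add (integrable_finsetSum _ fun i hi => ?_)
    obtain ⟨h1, hit⟩ := Finset.mem_Icc.1 hi
    exact (integrable_const (1 : ℝ)).indicator ((M.measurableSet_linkEvent (h1.trans hit)).inter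
      ((show Measurable fun ω : M.Sample => (ω.1 i, ω.1 (t + 1)) by fun_prop) hT))

/-- The expected number of links of `G_t` whose pair of endpoints lies in `T`. -/
noncomputable def meanCount (T : Set (Torus M.m × Torus M.m)) (t : ℕ) : ℝ :=
  ∫ ω, M.edgeCount T ω t ∂M.law

theorem edgeCount_nonneg (T : Set (Torus M.m × Torus M.m)) (ω : M.Sample) (t : ℕ) :
    0 ≤ M.edgeCount T ω t :=
  Finset.sum_nonneg fun _ _ => Set.indicator_nonneg (fun _ _ => zero_le_one) _

theorem meanCount_nonneg (T : Set (Torus M.m × Torus M.m)) (t : ℕ) : 0 ≤ M.meanCount T t :=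
  integral_nonneg fun ω => M.edgeCount_nonneg T ω t

theorem meanCount_zero (T : Set (Torus M.m × Torus M.m)) : M.meanCount T 0 = 0 := by
  simp [meanCount, edgeCount_zero]

theorem meanCount_succ {T : Set (Torus M.m × Torus M.m)} (hT : MeasurableSet T) (t : ℕ) :
    M.meanCount T (t + 1) = M.meanCount T t + M.p * ∑ i ∈ Finset.Icc 1 t,
      ∫ ω, M.hitProb T (ω.1 i) (inDeg (M.edges ω t) i) t ∂M.law := by
  have hI : ∀ i ∈ Finset.Icc 1 t, Integrable (fun ω =>
      (M.linkEvent t i ∩ {ω | (ω.1 i, ω.1 (t + 1)) ∈ T}).indicator (fun _ => (1 : ℝ)) ω) M.law := by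
    intro i hi
    obtain ⟨h1, hit⟩ := Finset.mem_Icc.1 hi
    exact (integrable_const (1 : ℝ)).indicator ((M.measurableSet_linkEvent (h1.trans hit)).inter
      ((show Measurable fun ω : M.Sample => (ω.1 i, ω.1 (t + 1)) by fun_prop) hT))
  simp only [meanCount, edgeCount_succ]
  rw [integral_add (M.integrable_edgeCount hT t) (integrable_finsetSum _ hI),
    integral_finsetSum _ hI, Finset.mul_sum]
  congr 1
  refine Finset.sum_congr rfl fun i hi => ?_
  simpa using M.integral_link hT (fun _ => 1) hi

theorem meanCount_mono {T T' : Set (Torus M.m × Torus M.m)} (hT : MeasurableSet T)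
    (hT' : MeasurableSet T') (h : T ⊆ T') (t : ℕ) : M.meanCount T t ≤ M.meanCount T' t :=
  integral_mono (M.integrable_edgeCount hT t) (M.integrable_edgeCount hT' t) fun _ =>
    Finset.sum_le_sum fun _ _ =>
      Set.indicator_le_indicator_of_subset h (fun _ => zero_le_one) _

theorem meanCount_union {T T' : Set (Torus M.m × Torus M.m)} (hT : MeasurableSet T)
    (hT' : MeasurableSet T') (h : Disjoint T T') (t : ℕ) :
    M.meanCount (T ∪ T') t = M.meanCount T t + M.meanCount T' t := by
  rw [meanCount, meanCount, meanCount,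
    ← integral_add (M.integrable_edgeCount hT t) (M.integrable_edgeCount hT' t)]
  congr 1
  funext ω
  rw [edgeCount, edgeCount, edgeCount, ← Finset.sum_add_distrib]
  refine Finset.sum_congr rfl fun e _ => ?_
  rw [Set.indicator_union_of_disjoint h]

theorem edgeCount_prod_univ (B : Set (Torus M.m)) (ω : M.Sample) (t : ℕ) :
    M.edgeCount (B ×ˢ univ) ω t = ∑ i ∈ Finset.Icc 1 t,
      B.indicator (fun _ => (inDeg (M.edges ω t) i : ℝ)) (ω.1 i) := by
  rw [edgeCount, ← Finset.sum_fiberwise_of_maps_to (t := Finset.Icc 1 t) (g := Prod.snd)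
    (fun e he => by have := M.mem_edges he; simp; omega)]
  refine Finset.sum_congr rfl fun i _ => ?_
  have : ∀ e ∈ (M.edges ω t).filter (fun e => e.2 = i),
      (B ×ˢ univ).indicator (fun _ => (1 : ℝ)) (ω.1 e.2, ω.1 e.1) =
        B.indicator (fun _ => 1) (ω.1 i) := by
    intro e he
    rw [(Finset.mem_filter.1 he).2]
    by_cases h : ω.1 i ∈ B <;> simp [h]
  rw [Finset.sum_congr rfl this, Finset.sum_const, inDeg]
  by_cases h : ω.1 i ∈ B <;> simp [h]

/-- The numerator `A₁ j + A₂` of the volume of the sphere of influence. -/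
noncomputable def weight (j : ℕ) : ℝ := M.A₁ * j + M.A₂

theorem weight_pos (j : ℕ) : 0 < M.weight j := by
  have := M.A₁_pos; have := M.A₂_pos; rw [weight]; positivity

/-- The expected total weight at time `t` of the nodes located in `B`. -/
noncomputable def meanWeight (B : Set (Torus M.m)) (t : ℕ) : ℝ :=
  ∑ i ∈ Finset.Icc 1 t, ∫ ω, B.indicator (fun _ => M.weight (inDeg (M.edges ω t) i)) (ω.1 i) ∂M.law

theorem integrable_indicator_inDeg {B : Set (Torus M.m)} (hB : MeasurableSet B) (h : ℕ → ℝ)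
    (t i : ℕ) : Integrable (fun ω : M.Sample =>
      B.indicator (fun _ => h (inDeg (M.edges ω t) i)) (ω.1 i)) M.law := by
  have := (M.integrable_inDeg h t i).indicator
    ((show Measurable fun ω : M.Sample => ω.1 i by fun_prop) hB)
  exact this

theorem law_real_node_mem {B : Set (Torus M.m)} (hB : MeasurableSet B) (i : ℕ) :
    M.law.real {ω | ω.1 i ∈ B} = M.nodeLaw.real B := by
  have h : MeasurePreserving (fun ω : M.Sample => ω.1 i) M.law M.nodeLaw :=
    (measurePreserving_eval_infinitePi (fun _ : ℕ => M.nodeLaw) i).comp measurePreserving_fst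
  rw [← h.map_eq, map_measureReal_apply h.measurable hB]
  rfl

/-- The in-degrees of the nodes in `B` add up to the number of links into `B`; this closes the
recursions for expected link counts. -/
theorem meanWeight_eq {B : Set (Torus M.m)} (hB : MeasurableSet B) (t : ℕ) :
    M.meanWeight B t = M.A₁ * M.meanCount (B ×ˢ univ) t + M.A₂ * M.nodeLaw.real B * t := by
  simp only [meanCount, edgeCount_prod_univ]
  rw [integral_finsetSum _ fun i _ => M.integrable_indicator_inDeg hB (fun j => (j : ℝ)) t i,
    Finset.mul_sum, meanWeight]
  have : M.A₂ * M.nodeLaw.real B * t =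
      ∑ i ∈ Finset.Icc 1 t, M.A₂ * ∫ ω, B.indicator (fun _ => (1 : ℝ)) (ω.1 i) ∂M.law := by
    rw [← Finset.mul_sum, Finset.sum_congr rfl (g := fun _ => M.nodeLaw.real B)]
    · simp; ring
    · intro i _
      rw [← M.law_real_node_mem hB i]
      have hm : MeasurableSet {ω : M.Sample | ω.1 i ∈ B} :=
        (show Measurable fun ω : M.Sample => ω.1 i by fun_prop) hB
      rw [← integral_indicator_one hm]
      rfl
  rw [this, ← Finset.sum_add_distrib]
  refine Finset.sum_congr rfl fun i _ => ?_
  rw [← integral_const_mul, ← integral_const_mul, ← integral_add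
    ((M.integrable_indicator_inDeg hB (fun j => (j : ℝ)) t i).const_mul _)
    ((M.integrable_indicator_inDeg hB (fun _ => (1 : ℝ)) t i).const_mul _)]
  congr 1
  funext ω
  by_cases h : ω.1 i ∈ B <;> simp [h, weight]

end Model
end SPA

/-! ### Linear recursions with vanishing error -/

namespace SPA

/-- Since `1 - u ≤ exp (-u)`, the product `x t * exp (c * H t)`, with `H` the harmonic sums, is
eventually nonincreasing; divergence of `H` forces `x` to 0. -/
theorem tendsto_zero_of_contraction {x : ℕ → ℝ} {c : ℝ} (hc0 : 0 < c)
    (hx : ∀ t, 0 ≤ x t)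
    (h : ∀ᶠ t : ℕ in atTop, ((t : ℝ) + 1) * x (t + 1) ≤ ((t : ℝ) + 1 - c) * x t) :
    Tendsto x atTop (𝓝 0) := by
  set H : ℕ → ℝ := fun n => ∑ i ∈ Finset.range n, 1 / ((i : ℝ) + 1) with hH
  obtain ⟨T, hT⟩ := eventually_atTop.1 h
  have hbound : ∀ t ≥ T, x t * Real.exp (c * H t) ≤ x T * Real.exp (c * H T) := by
    intro t ht
    induction t, ht using Nat.le_induction with
    | base => exact le_rfl
    | succ t ht ih =>
      refine le_trans ?_ ih
      have ht0 : (0 : ℝ) < (t : ℝ) + 1 := by positivity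
      have h1 : x (t + 1) ≤ (1 - c / ((t : ℝ) + 1)) * x t := by
        rw [← mul_le_mul_iff_right₀ ht0]
        refine (hT t ht).trans_eq ?_
        field_simp
      have h2 : 1 - c / ((t : ℝ) + 1) ≤ Real.exp (-(c / ((t : ℝ) + 1))) := by
        have := Real.add_one_le_exp (-(c / ((t : ℝ) + 1)))
        linarith
      have h3 : H (t + 1) = H t + 1 / ((t : ℝ) + 1) := Finset.sum_range_succ _ _
      calc x (t + 1) * Real.exp (c * H (t + 1))
          ≤ (Real.exp (-(c / ((t : ℝ) + 1))) * x t) * Real.exp (c * H (t + 1)) :=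
            mul_le_mul_of_nonneg_right (h1.trans (mul_le_mul_of_nonneg_right h2 (hx t)))
              (Real.exp_pos _).le
        _ = x t * (Real.exp (-(c / ((t : ℝ) + 1))) * Real.exp (c * H (t + 1))) := by ring
        _ = x t * Real.exp (c * H t) := by
            rw [← Real.exp_add, h3]; congr 2; ring
  have hlim : Tendsto (fun t => x T * Real.exp (c * H T) * Real.exp (-(c * H t))) atTop (𝓝 0) := by
    rw [← mul_zero (x T * Real.exp (c * H T))]
    refine Tendsto.const_mul _ (Real.tendsto_exp_neg_atTop_nhds_zero.comp ?_)
    exact Real.tendsto_sum_range_one_div_nat_succ_atTop.const_mul_atTop hc0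
  refine squeeze_zero' (Eventually.of_forall hx) ?_ hlim
  filter_upwards [eventually_ge_atTop T] with t ht
  rw [Real.exp_neg, ← div_eq_mul_inv, le_div_iff₀ (Real.exp_pos _)]
  exact hbound t ht

/-- The positive part of `x - r / 2` satisfies the error-free recursion once `ε t < c * (r / 2)`:
shifting by `r / 2` gains exactly `c * (r / 2)`. The bound `c ≤ 1` keeps the factor `t + 1 - c`
nonnegative. -/
theorem tendsto_zero_of_recursion {x ε : ℕ → ℝ} {c : ℝ} (hc0 : 0 < c) (hc1 : c ≤ 1)
    (hx : ∀ t, 0 ≤ x t) (hε : Tendsto ε atTop (𝓝 0))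
    (h : ∀ t : ℕ, 1 ≤ t → ((t : ℝ) + 1) * x (t + 1) ≤ ((t : ℝ) + 1 - c) * x t + ε t) :
    Tendsto x atTop (𝓝 0) := by
  rw [Metric.tendsto_atTop']
  intro r hr
  have hu : Tendsto (fun t => max (x t - r / 2) 0) atTop (𝓝 0) := by
    refine tendsto_zero_of_contraction hc0 (fun t => le_max_right _ _) ?_
    filter_upwards [eventually_ge_atTop 1,
      hε.eventually (gt_mem_nhds (show 0 < c * (r / 2) by positivity))] with t ht hεt
    have h1 := h t ht
    have ht0 : (0 : ℝ) ≤ (t : ℝ) := by positivity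
    have h2 : (0 : ℝ) ≤ ((t : ℝ) + 1 - c) * max (x t - r / 2) 0 :=
      mul_nonneg (by linarith) (le_max_right _ _)
    rcases le_total (x (t + 1) - r / 2) 0 with h3 | h3
    · rw [max_eq_right h3, mul_zero]; exact h2
    · rw [max_eq_left h3]
      have h4 : ((t : ℝ) + 1 - c) * (x t - r / 2) ≤ ((t : ℝ) + 1 - c) * max (x t - r / 2) 0 :=
        mul_le_mul_of_nonneg_left (le_max_left _ _) (by linarith)
      nlinarith
  obtain ⟨N, hN⟩ := eventually_atTop.1 (hu.eventually (gt_mem_nhds (half_pos hr)))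
  refine ⟨N, fun n hn => ?_⟩
  rw [Real.dist_eq, sub_zero, abs_of_nonneg (hx n)]
  have := (le_max_left (x n - r / 2) 0).trans_lt (hN n hn.le)
  linarith

/-! ### Moment bounds and leaked volume -/

namespace Model

variable (M : Model)

theorem volume_sphere (x : Torus M.m) (j : ℕ) {t : ℕ} (ht : 1 ≤ t) :
    volume.real (M.sphere x j t) = min 1 (M.weight j / t) :=
  M.metric.volume_ballOfVolume x (div_pos (M.weight_pos j) (by exact_mod_cast ht))

theorem measurableSet_sphere_inter {T : Set (Torus M.m × Torus M.m)} (hT : MeasurableSet T)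
    (x : Torus M.m) (j : ℕ) {t : ℕ} (ht : 1 ≤ t) :
    MeasurableSet (M.sphere x j t ∩ Prod.mk x ⁻¹' T) :=
  measurable_prodMk_left ((M.measurableSet_sphere j ht).inter hT)

theorem hitProb_nonneg (T : Set (Torus M.m × Torus M.m)) (x : Torus M.m) (j t : ℕ) :
    0 ≤ M.hitProb T x j t := measureReal_nonneg

theorem hitProb_le_one (T : Set (Torus M.m × Torus M.m)) (x : Torus M.m) (j t : ℕ) :
    M.hitProb T x j t ≤ 1 := measureReal_le_one

theorem hitProb_le {R : ℝ} (h0 : 0 ≤ R) (hR : ∀ ℓ, M.ρ ℓ ≤ R) {T : Set (Torus M.m × Torus M.m)}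
    (hT : MeasurableSet T) (x : Torus M.m) (j : ℕ) {t : ℕ} (ht : 1 ≤ t) :
    M.hitProb T x j t ≤ R * (M.weight j / t) :=
  (M.nodeLaw_real_le h0 hR (M.measurableSet_sphere_inter hT x j ht)).trans
    (mul_le_mul_of_nonneg_left ((measureReal_mono inter_subset_left).trans
      ((M.volume_sphere x j ht).trans_le (min_le_right _ _))) h0)

theorem hitProb_crossing_le {R : ℝ} (h0 : 0 ≤ R) (hR : ∀ ℓ, M.ρ ℓ ≤ R) (x : Torus M.m) (j : ℕ)
    {t : ℕ} (ht : 1 ≤ t) :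
    M.hitProb M.crossing x j t ≤ R * M.outerVolume x (M.weight j / t) :=
  M.nodeLaw_real_le h0 hR (M.measurableSet_sphere_inter M.measurableSet_crossing x j ht)

theorem hitProb_prod_univ_le {R : ℝ} (h0 : 0 ≤ R) (hR : ∀ ℓ, M.ρ ℓ ≤ R) {B : Set (Torus M.m)}
    (hB : MeasurableSet B) (x : Torus M.m) (j : ℕ) {t : ℕ} (ht : 1 ≤ t) :
    M.hitProb (B ×ˢ univ) x j t ≤ B.indicator (fun _ => R * (M.weight j / t)) x := by
  by_cases hx : x ∈ B
  · rw [Set.indicator_of_mem hx]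
    exact M.hitProb_le h0 hR (hB.prod MeasurableSet.univ) x j ht
  · rw [Set.indicator_of_notMem hx, hitProb]
    simp [hx]

theorem integrable_hitProb {T : Set (Torus M.m × Torus M.m)} (hT : MeasurableSet T) {t : ℕ}
    (ht : 1 ≤ t) (i : ℕ) :
    Integrable (fun ω : M.Sample => M.hitProb T (ω.1 i) (inDeg (M.edges ω t) i) t) M.law :=
  M.integrable_inDeg_comp (f := fun j x => M.hitProb T x j t)
    (fun j => M.measurable_hitProb hT j ht) i (C := 1) fun j _ x => by
      rw [abs_of_nonneg (M.hitProb_nonneg T x j t)]; exact M.hitProb_le_one T x j t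

/-- Proportionality to the measure of `B` is the point: it makes the nodes of a small set carry a
small share of the total weight. -/
theorem meanCount_prod_univ_le {R : ℝ} (h0 : 0 ≤ R) (hR : ∀ ℓ, M.ρ ℓ ≤ R)
    (h1 : M.p * M.A₁ * R < 1) {B : Set (Torus M.m)} (hB : MeasurableSet B) (t : ℕ) :
    M.meanCount (B ×ˢ univ) t ≤
      M.p * R * M.A₂ / (1 - M.p * M.A₁ * R) * M.nodeLaw.real B * t := by
  -- The constant `C` solves `C = p * A₁ * R * C + p * R * A₂`, exactly what the induction step
  -- needs.
  have hC : M.p * R * M.A₂ / (1 - M.p * M.A₁ * R) * (1 - M.p * M.A₁ * R) = M.p * R * M.A₂ :=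
    div_mul_cancel₀ _ (by linarith)
  set C := M.p * R * M.A₂ / (1 - M.p * M.A₁ * R)
  have hp := M.p_pos
  have hA₁ := M.A₁_pos
  induction t with
  | zero => simp [meanCount_zero]
  | succ t ih =>
    rw [M.meanCount_succ (hB.prod MeasurableSet.univ)]
    -- Time 0 is separate, since the spheres have volume `weight / t`; the first node creates no
    -- link.
    rcases Nat.eq_zero_or_pos t with rfl | ht
    · have hC0 : 0 ≤ C := by
        have := M.A₂_pos
        exact div_nonneg (by positivity) (by linarith)
      simp only [Finset.Icc_eq_empty_of_lt one_pos, Finset.sum_empty, meanCount_zero]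
      have := measureReal_nonneg (μ := M.nodeLaw) (s := B)
      push_cast
      nlinarith [mul_nonneg hC0 this]
    · have ht' : (0 : ℝ) < t := by exact_mod_cast ht
      have hs : ∑ i ∈ Finset.Icc 1 t, ∫ ω, M.hitProb (B ×ˢ univ) (ω.1 i)
          (inDeg (M.edges ω t) i) t ∂M.law ≤ R / t * M.meanWeight B t := by
        rw [meanWeight, Finset.mul_sum]
        refine Finset.sum_le_sum fun i _ => ?_
        rw [← integral_const_mul]
        refine integral_mono (M.integrable_hitProb (hB.prod MeasurableSet.univ) ht i)
          ((M.integrable_indicator_inDeg hB M.weight t i).const_mul _) fun ω => ?_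
        refine (M.hitProb_prod_univ_le h0 hR hB _ _ ht).trans_eq ?_
        by_cases h : ω.1 i ∈ B
        · simp only [Set.indicator_of_mem h]; ring
        · simp only [Set.indicator_of_notMem h]; ring
      rw [M.meanWeight_eq hB] at hs
      set N := M.meanCount (B ×ˢ univ) t
      set ν := M.nodeLaw.real B
      have hN : N / t ≤ C * ν := by rw [div_le_iff₀ ht']; exact ih
      have e1 : M.p * (R / t * (M.A₁ * N + M.A₂ * ν * t)) =
          M.p * M.A₁ * R * (N / t) + M.p * R * M.A₂ * ν := by
        field_simp
      have e2 := mul_le_mul_of_nonneg_left hs hp.le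
      have e3 := mul_le_mul_of_nonneg_left hN (show 0 ≤ M.p * M.A₁ * R by positivity)
      rw [e1, ← hC] at e2
      push_cast
      linarith

theorem exists_meanWeight_le : ∃ K : ℝ, 0 ≤ K ∧ ∀ B : Set (Torus M.m), MeasurableSet B → ∀ t : ℕ,
    M.meanWeight B t ≤ K * M.nodeLaw.real B * t := by
  obtain ⟨R, h0, hR, h1⟩ := M.exists_ρ_bound
  have hp := M.p_pos
  have hA₁ := M.A₁_pos
  have hA₂ := M.A₂_pos
  refine ⟨M.A₁ * (M.p * R * M.A₂ / (1 - M.p * M.A₁ * R)) + M.A₂,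
    add_nonneg (mul_nonneg hA₁.le (div_nonneg (by positivity) (by linarith))) hA₂.le,
    fun B hB t => ?_⟩
  rw [M.meanWeight_eq hB]
  have := mul_le_mul_of_nonneg_left (M.meanCount_prod_univ_le h0 hR h1 hB t) hA₁.le
  linarith

/-- The expected sum of the squared weights at time `t`. -/
noncomputable def meanSq (t : ℕ) : ℝ :=
  ∑ i ∈ Finset.Icc 1 t, ∫ ω, M.weight (inDeg (M.edges ω t) i) ^ 2 ∂M.law

theorem meanSq_nonneg (t : ℕ) : 0 ≤ M.meanSq t :=
  Finset.sum_nonneg fun _ _ => integral_nonneg fun _ => sq_nonneg _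

/-- A link raises `w ^ 2` by `2 * A₁ * w + A₁ ^ 2` and has conditional probability at most `p * R *
w / t`; the new node adds `A₂ ^ 2`. -/
theorem meanSq_succ_le {R : ℝ} (h0 : 0 ≤ R) (hR : ∀ ℓ, M.ρ ℓ ≤ R) {t : ℕ} (ht : 1 ≤ t) :
    M.meanSq (t + 1) ≤ M.A₂ ^ 2 + (1 + 2 * (M.p * M.A₁ * R) / t) * M.meanSq t +
      M.A₁ * (M.p * M.A₁ * R) / t * M.meanWeight univ t := by
  have hp := M.p_pos
  have hA₁ := M.A₁_pos
  have hnew : ∫ ω, M.weight (inDeg (M.edges ω (t + 1)) (t + 1)) ^ 2 ∂M.law = M.A₂ ^ 2 := by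
    simp [M.inDeg_eq_zero le_rfl, weight]
  have hstep : ∀ i ∈ Finset.Icc 1 t, ∫ ω, M.weight (inDeg (M.edges ω (t + 1)) i) ^ 2 ∂M.law ≤
      (1 + 2 * (M.p * M.A₁ * R) / t) * ∫ ω, M.weight (inDeg (M.edges ω t) i) ^ 2 ∂M.law +
      M.A₁ * (M.p * M.A₁ * R) / t *
        ∫ ω, univ.indicator (fun _ => M.weight (inDeg (M.edges ω t) i)) (ω.1 i) ∂M.law := by
    intro i hi
    obtain ⟨h1, hit⟩ := Finset.mem_Icc.1 hi
    set h : ℕ → ℝ := fun j => 2 * M.A₁ * M.weight j + M.A₁ ^ 2 with hh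
    have hl := M.integral_link MeasurableSet.univ h hi
    have hi1 := M.integrable_inDeg (fun j => M.weight j ^ 2) t i
    have hi2 := (M.integrable_inDeg h t i).indicator ((M.measurableSet_linkEvent ht (i := i)).inter
      ((show Measurable fun ω : M.Sample => (ω.1 i, ω.1 (t + 1)) by fun_prop)
        (MeasurableSet.univ : MeasurableSet (univ : Set (Torus M.m × Torus M.m)))))
    have e1 : ∫ ω, M.weight (inDeg (M.edges ω (t + 1)) i) ^ 2 ∂M.law =
        ∫ ω, M.weight (inDeg (M.edges ω t) i) ^ 2 ∂M.law + M.p * ∫ ω, h (inDeg (M.edges ω t) i) *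
          M.hitProb univ (ω.1 i) (inDeg (M.edges ω t) i) t ∂M.law := by
      rw [← hl]
      refine Eq.trans ?_ (integral_add hi1 hi2)
      congr 1
      funext ω
      have hd := M.inDeg_succ ω h1 hit
      simp only [Set.mem_univ, Set.ofPred_true, Set.inter_univ, hh]
      by_cases hω : ω ∈ M.linkEvent t i
      · rw [Set.indicator_of_mem hω] at hd ⊢
        rw [weight, hd, weight]; ring
      · rw [Set.indicator_of_notMem hω] at hd ⊢
        rw [weight, hd, weight]; ring
    have e2 : ∫ ω, h (inDeg (M.edges ω t) i) *
          M.hitProb univ (ω.1 i) (inDeg (M.edges ω t) i) t ∂M.law ≤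
        ∫ ω, h (inDeg (M.edges ω t) i) * (R * (M.weight (inDeg (M.edges ω t) i) / t)) ∂M.law := by
      refine integral_mono_of_nonneg (ae_of_all _ fun ω => ?_)
        (M.integrable_inDeg (fun j => h j * (R * (M.weight j / t))) t i) (ae_of_all _ fun ω => ?_)
      · have := M.weight_pos (inDeg (M.edges ω t) i)
        exact mul_nonneg (by positivity) (M.hitProb_nonneg _ _ _ _)
      · have := M.weight_pos (inDeg (M.edges ω t) i)
        exact mul_le_mul_of_nonneg_left (M.hitProb_le h0 hR MeasurableSet.univ _ _ ht)
          (by positivity)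
    have e3 : M.p * ∫ ω, h (inDeg (M.edges ω t) i) *
          (R * (M.weight (inDeg (M.edges ω t) i) / t)) ∂M.law =
        2 * (M.p * M.A₁ * R) / t * ∫ ω, M.weight (inDeg (M.edges ω t) i) ^ 2 ∂M.law +
        M.A₁ * (M.p * M.A₁ * R) / t *
          ∫ ω, univ.indicator (fun _ => M.weight (inDeg (M.edges ω t) i)) (ω.1 i) ∂M.law := by
      rw [← integral_const_mul, ← integral_const_mul, ← integral_const_mul,
        ← integral_add (hi1.const_mul _)
          ((M.integrable_indicator_inDeg MeasurableSet.univ M.weight t i).const_mul _)]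
      congr 1
      funext ω
      simp only [Set.indicator_univ, hh]
      ring
    have e4 := mul_le_mul_of_nonneg_left e2 hp.le
    rw [e3] at e4
    rw [e1]
    linarith
  rw [meanSq, Finset.sum_Icc_succ_top (by omega), hnew]
  have := Finset.sum_le_sum hstep
  rw [Finset.sum_add_distrib, ← Finset.mul_sum, ← Finset.mul_sum] at this
  rw [meanSq, meanWeight]
  linarith

/-- The growth factor `1 + 2 * lam / t` with `lam < 1` stays below that of `t ^ 2`, and the
inhomogeneous terms are bounded. -/
theorem tendsto_meanSq_div : Tendsto (fun t : ℕ => M.meanSq t / (t : ℝ) ^ 2) atTop (𝓝 0) := by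
  obtain ⟨R, h0, hR, h1⟩ := M.exists_ρ_bound
  obtain ⟨K, hK0, hK⟩ := M.exists_meanWeight_le
  have hp := M.p_pos
  have hA₁ := M.A₁_pos
  set lam := M.p * M.A₁ * R with hlam
  have hlam0 : 0 ≤ lam := by positivity
  set D := M.A₂ ^ 2 + M.A₁ * lam * K with hD
  refine tendsto_zero_of_recursion (c := 1 - lam) (ε := fun t => D / ((t : ℝ) + 1)) (by linarith)
    (by linarith) (fun t => div_nonneg (M.meanSq_nonneg t) (sq_nonneg _)) ?_ fun t ht => ?_
  · have := (tendsto_one_div_add_atTop_nhds_zero_nat (𝕜 := ℝ)).const_mul D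
    simpa [div_eq_mul_inv] using this
  · have ht' : (0 : ℝ) < t := by exact_mod_cast ht
    have hs := M.meanSq_succ_le h0 hR ht
    rw [← hlam] at hs
    have hw := hK univ MeasurableSet.univ t
    rw [probReal_univ, mul_one] at hw
    have h2 : M.A₁ * lam / t * M.meanWeight univ t ≤ M.A₁ * lam * K := by
      refine (mul_le_mul_of_nonneg_left hw (by positivity)).trans_eq ?_
      field_simp
    have hS := M.meanSq_nonneg t
    have h3 : M.meanSq (t + 1) ≤ D + (1 + 2 * lam / t) * M.meanSq t := by linarith
    have e1 : ((t : ℝ) + 1) * (M.meanSq (t + 1) / ((t + 1 : ℕ) : ℝ) ^ 2) =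
        M.meanSq (t + 1) / ((t : ℝ) + 1) := by
      push_cast; field_simp
    have e2 : ((t : ℝ) + 1 - (1 - lam)) * (M.meanSq t / (t : ℝ) ^ 2) + D / ((t : ℝ) + 1) =
        ((t + lam) * ((t : ℝ) + 1) / (t : ℝ) ^ 2 * M.meanSq t + D) / ((t : ℝ) + 1) := by
      field_simp; ring
    rw [e1, e2]
    gcongr
    -- After multiplication by `t ^ 2` this reads `lam * t ≤ t + lam`, which follows from `lam ≤ 1`.
    have h4 : 1 + 2 * lam / t ≤ (t + lam) * ((t : ℝ) + 1) / (t : ℝ) ^ 2 := by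
      rw [le_div_iff₀ (by positivity)]
      have : (1 + 2 * lam / t) * (t : ℝ) ^ 2 = (t : ℝ) ^ 2 + 2 * lam * t := by field_simp
      rw [this]
      nlinarith
    linarith [mul_le_mul_of_nonneg_right h4 hS]

/-- The expected total volume of the parts of the spheres of influence outside the region of their
centre. -/
noncomputable def meanOuterVolume (t : ℕ) : ℝ :=
  ∑ i ∈ Finset.Icc 1 t, ∫ ω, M.outerVolume (ω.1 i) (M.weight (inDeg (M.edges ω t) i) / t) ∂M.law

theorem outerVolume_nonneg (x : Torus M.m) (a : ℝ) : 0 ≤ M.outerVolume x a := measureReal_nonneg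

theorem weight_div_pos (j : ℕ) {t : ℕ} (ht : 1 ≤ t) : 0 < M.weight j / t :=
  div_pos (M.weight_pos j) (by exact_mod_cast ht)

theorem integrable_outerVolume {t : ℕ} (ht : 1 ≤ t) (i : ℕ) :
    Integrable (fun ω : M.Sample =>
      M.outerVolume (ω.1 i) (M.weight (inDeg (M.edges ω t) i) / t)) M.law :=
  M.integrable_inDeg_comp (f := fun j x => M.outerVolume x (M.weight j / t))
    (fun j => M.measurable_outerVolume (M.weight_div_pos j ht)) i (C := 1) fun j _ x => by
      rw [abs_of_nonneg (M.outerVolume_nonneg x _)]; exact measureReal_le_one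

theorem meanOuterVolume_nonneg (t : ℕ) : 0 ≤ M.meanOuterVolume t :=
  Finset.sum_nonneg fun _ _ => integral_nonneg fun _ => M.outerVolume_nonneg _ _

theorem meanOuterVolume_le (j : ℕ) {t : ℕ} (ht : 1 ≤ t) :
    M.meanOuterVolume t ≤ M.meanWeight (M.nearBoundary j) t / t +
      ((j : ℝ) + 1) * (M.meanSq t / (t : ℝ) ^ 2) := by
  rw [meanOuterVolume, meanWeight, meanSq, Finset.sum_div, Finset.sum_div, Finset.mul_sum,
    ← Finset.sum_add_distrib]
  refine Finset.sum_le_sum fun i _ => ?_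
  have hi1 := (M.integrable_indicator_inDeg (M.measurableSet_nearBoundary j) M.weight t i).div_const
    (t : ℝ)
  have hi2 := ((M.integrable_inDeg (fun j => M.weight j ^ 2) t i).div_const
    ((t : ℝ) ^ 2)).const_mul ((j : ℝ) + 1)
  rw [← integral_div, ← integral_div, ← integral_const_mul, ← integral_add hi1 hi2]
  refine integral_mono (M.integrable_outerVolume ht i) (hi1.add hi2) fun ω => ?_
  refine (M.outerVolume_le_indicator_add (ω.1 i) (M.weight_div_pos _ ht) j).trans_eq ?_
  rw [div_pow]
  congr 1
  by_cases h : ω.1 i ∈ M.nearBoundary j <;> simp [h]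

theorem tendsto_meanOuterVolume : Tendsto M.meanOuterVolume atTop (𝓝 0) := by
  obtain ⟨K, hK0, hK⟩ := M.exists_meanWeight_le
  rw [Metric.tendsto_atTop']
  intro r hr
  have h1 : Tendsto (fun j => K * M.nodeLaw.real (M.nearBoundary j)) atTop (𝓝 0) := by
    simpa using M.tendsto_nodeLaw_nearBoundary.const_mul K
  -- First `j` is fixed to make the boundary term small uniformly in `t`; only then does `t` grow to
  -- suppress the quadratic term.
  obtain ⟨j, hj⟩ := (h1.eventually (gt_mem_nhds (half_pos hr))).exists
  have h2 : Tendsto (fun t : ℕ => ((j : ℝ) + 1) * (M.meanSq t / (t : ℝ) ^ 2)) atTop (𝓝 0) := by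
    simpa using M.tendsto_meanSq_div.const_mul ((j : ℝ) + 1)
  obtain ⟨N, hN⟩ := eventually_atTop.1 (h2.eventually (gt_mem_nhds (half_pos hr)))
  refine ⟨N, fun t ht => ?_⟩
  have ht1 : 1 ≤ t := by omega
  have ht' : (0 : ℝ) < t := by exact_mod_cast ht1
  rw [Real.dist_eq, sub_zero, abs_of_nonneg (M.meanOuterVolume_nonneg t)]
  have h3 := M.meanOuterVolume_le j ht1
  have h4 : M.meanWeight (M.nearBoundary j) t / t ≤ K * M.nodeLaw.real (M.nearBoundary j) := by
    rw [div_le_iff₀ ht']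
    exact hK _ (M.measurableSet_nearBoundary j) t
  have := hN t ht.le
  linarith

/-! ### Asymptotics of expected link counts -/

theorem tendsto_meanCount_crossing_div :
    Tendsto (fun t : ℕ => M.meanCount M.crossing t / t) atTop (𝓝 0) := by
  obtain ⟨R, h0, hR, -⟩ := M.exists_ρ_bound
  -- With `c = 1` the recursion is Cesàro averaging: the increments of the mean are at most `p * R *
  -- meanOuterVolume`, which tends to 0.
  refine tendsto_zero_of_recursion (c := 1) (ε := fun t => M.p * R * M.meanOuterVolume t) one_pos
    le_rfl (fun t => div_nonneg (M.meanCount_nonneg _ t) (Nat.cast_nonneg t)) ?_ fun t ht => ?_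
  · simpa using M.tendsto_meanOuterVolume.const_mul (M.p * R)
  · have ht' : (0 : ℝ) < t := by exact_mod_cast ht
    have hs : ∑ i ∈ Finset.Icc 1 t, ∫ ω, M.hitProb M.crossing (ω.1 i) (inDeg (M.edges ω t) i) t
        ∂M.law ≤ R * M.meanOuterVolume t := by
      rw [meanOuterVolume, Finset.mul_sum]
      refine Finset.sum_le_sum fun i _ => ?_
      rw [← integral_const_mul]
      exact integral_mono (M.integrable_hitProb M.measurableSet_crossing ht i)
        ((M.integrable_outerVolume ht i).const_mul R)
        fun ω => M.hitProb_crossing_le h0 hR _ _ ht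
    have e1 : ((t : ℝ) + 1) * (M.meanCount M.crossing (t + 1) / ((t + 1 : ℕ) : ℝ)) =
        M.meanCount M.crossing (t + 1) := by push_cast; field_simp
    have e2 : ((t : ℝ) + 1 - 1) * (M.meanCount M.crossing t / t) = M.meanCount M.crossing t := by
      field_simp; ring
    rw [e1, e2, M.meanCount_succ M.measurableSet_crossing, mul_assoc]
    gcongr
    exact M.p_pos.le

theorem hitProb_region_eq (ℓ : M.Label) (x : Torus M.m) (j : ℕ) {t : ℕ} (ht : 1 ≤ t) :
    M.hitProb (region ℓ ×ˢ region ℓ) x j t =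
      (region ℓ).indicator (fun x => M.ρ ℓ *
        (min 1 (M.weight j / t) - M.outerVolume x (M.weight j / t))) x := by
  by_cases hx : x ∈ region ℓ
  · have hT := (measurableSet_region ℓ).prod (measurableSet_region ℓ)
    rw [Set.indicator_of_mem hx, hitProb, M.nodeLaw_real_of_subset
      (M.measurableSet_sphere_inter hT x j ht) (fun y hy => hy.2.2), ← M.volume_sphere x j ht]
    congr 1
    have hcross : MeasurableSet (Prod.mk x ⁻¹' M.crossing) :=
      measurable_prodMk_left M.measurableSet_crossing
    have h := measureReal_inter_add_sdiff (μ := volume) (s := M.sphere x j t) hcross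
    rw [← h, show M.outerVolume x (M.weight j / t) =
      volume.real (M.sphere x j t ∩ Prod.mk x ⁻¹' M.crossing) from rfl, add_sub_cancel_left]
    congr 1
    ext y
    simp only [mem_inter_iff, mem_preimage, mem_prod, Set.mem_sdiff, crossing, Set.mem_ofPred_eq, not_not]
    refine and_congr_right fun _ => ⟨fun h => ⟨ℓ, h⟩, ?_⟩
    rintro ⟨ℓ', h1, h2⟩
    rw [(existsUnique_region M.k_pos x).unique h1 hx] at h2
    exact ⟨hx, h2⟩
  · rw [Set.indicator_of_notMem hx, hitProb]
    simp [hx]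

theorem sub_min_one_le_sq {a : ℝ} : a - min 1 a ≤ a ^ 2 := by
  rcases min_cases 1 a with ⟨h, h'⟩ | ⟨h, h'⟩ <;> rw [h] <;> nlinarith

/-- For a centre in the region, the hit probability differs from `ρ ℓ * a` only by truncation at 1,
which costs at most `a ^ 2`, and by the leaked volume. -/
theorem abs_sum_hitProb_region_sub_le (ℓ : M.Label) {t : ℕ} (ht : 1 ≤ t) :
    |∑ i ∈ Finset.Icc 1 t, ∫ ω, M.hitProb (region ℓ ×ˢ region ℓ) (ω.1 i)
        (inDeg (M.edges ω t) i) t ∂M.law - M.ρ ℓ * (M.meanWeight (region ℓ) t / t)| ≤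
      M.ρ ℓ * (M.meanSq t / (t : ℝ) ^ 2 + M.meanOuterVolume t) := by
  have hT := (measurableSet_region ℓ).prod (measurableSet_region ℓ)
  rw [meanWeight, meanSq, meanOuterVolume, Finset.sum_div, Finset.sum_div, Finset.mul_sum,
    ← Finset.sum_sub_distrib, ← Finset.sum_add_distrib, Finset.mul_sum]
  refine (Finset.abs_sum_le_sum_abs _ _).trans (Finset.sum_le_sum fun i _ => ?_)
  have hi1 := ((M.integrable_indicator_inDeg (measurableSet_region ℓ) M.weight t i).div_const
    (t : ℝ)).const_mul (M.ρ ℓ)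
  have hi2 := (M.integrable_inDeg (fun j => M.weight j ^ 2) t i).div_const ((t : ℝ) ^ 2)
  have hi3 := M.integrable_outerVolume ht i
  rw [← integral_div, ← integral_div, ← integral_const_mul, ← integral_add hi2 hi3,
    ← integral_const_mul, ← integral_sub (M.integrable_hitProb hT ht i) hi1]
  refine (abs_integral_le_integral_abs).trans (integral_mono
    ((M.integrable_hitProb hT ht i).sub hi1).abs ((hi2.add hi3).const_mul _) fun ω => ?_)
  have hρ := M.ρ_nonneg ℓ
  have ho := M.outerVolume_nonneg (ω.1 i) (M.weight (inDeg (M.edges ω t) i) / t)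
  rw [← div_pow] at *
  simp only [M.hitProb_region_eq ℓ _ _ ht]
  set a := M.weight (inDeg (M.edges ω t) i) / (t : ℝ) with ha
  by_cases h : ω.1 i ∈ region ℓ
  · simp only [Set.indicator_of_mem h]
    rw [← ha, ← mul_sub, abs_mul, abs_of_nonneg hρ]
    refine mul_le_mul_of_nonneg_left ?_ hρ
    have h1 : a - min 1 a ≤ a ^ 2 := sub_min_one_le_sq
    have h2 : min 1 a ≤ a := min_le_right _ _
    rw [abs_le]; constructor <;> linarith [sq_nonneg a]
  · simp only [Set.indicator_of_notMem h]
    simp only [zero_div, mul_zero, sub_zero, abs_zero]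
    positivity

theorem tendsto_meanCount_region_div (ℓ : M.Label) :
    Tendsto (fun t : ℕ => M.meanCount (region ℓ ×ˢ region ℓ) t / t) atTop
      (𝓝 (M.p * M.ρ ℓ * M.A₂ / (1 - M.p * M.ρ ℓ * M.A₁) * M.q ℓ)) := by
  have hp := M.p_pos
  have hA₁ := M.A₁_pos
  have hρ := M.ρ_nonneg ℓ
  set lam := M.p * M.ρ ℓ * M.A₁ with hlam
  have hlam0 : 0 ≤ lam := by positivity
  have hlam1 : lam < 1 := by have := M.subcritical ℓ; rw [hlam]; linarith
  set c := M.p * M.ρ ℓ * M.A₂ / (1 - lam) * M.q ℓ with hc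
  -- The limit `c` is the fixed point of `c = lam * c + p * ρ ℓ * A₂ * q ℓ`.
  have hcl : c * (1 - lam) = M.p * M.ρ ℓ * M.A₂ * M.q ℓ := by
    have : 1 - lam ≠ 0 := by linarith
    rw [hc]; field_simp
  have hR := measurableSet_region ℓ
  have hT := hR.prod hR
  set e := M.meanCount (region ℓ ×ˢ region ℓ) with he
  rw [tendsto_iff_dist_tendsto_zero]
  simp only [Real.dist_eq]
  refine tendsto_zero_of_recursion (c := 1 - lam) (ε := fun t => lam * (M.meanCount M.crossing t / t)
    + M.p * (M.ρ ℓ * (M.meanSq t / (t : ℝ) ^ 2 + M.meanOuterVolume t))) (by linarith) (by linarith)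
    (fun t => abs_nonneg _) ?_ fun t ht => ?_
  · simpa using (M.tendsto_meanCount_crossing_div.const_mul lam).add
      (((M.tendsto_meanSq_div.add M.tendsto_meanOuterVolume).const_mul (M.ρ ℓ)).const_mul M.p)
  · have ht' : (0 : ℝ) < t := by exact_mod_cast ht
    -- Links into ℓ from other regions also raise the in-degrees; they are crossing links, so their
    -- contribution is an error term.
    have hdec : M.meanCount (region ℓ ×ˢ univ) t =
        e t + M.meanCount (region ℓ ×ˢ (region ℓ)ᶜ) t := by
      rw [he, ← M.meanCount_union hT (hR.prod hR.compl) _ t]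
      · rw [← Set.prod_union, Set.union_compl_self]
      · exact Set.disjoint_left.2 fun z h1 h2 => h2.2 h1.2
    have hx0 := M.meanCount_nonneg (region ℓ ×ˢ (region ℓ)ᶜ) t
    have hx1 : M.meanCount (region ℓ ×ˢ (region ℓ)ᶜ) t ≤ M.meanCount M.crossing t := by
      refine M.meanCount_mono (hR.prod hR.compl) M.measurableSet_crossing ?_ t
      rintro z ⟨h1, h2⟩ ⟨ℓ', h3, h4⟩
      rw [(existsUnique_region M.k_pos z.1).unique h3 h1] at h4
      exact h2 h4
    set x := M.meanCount (region ℓ ×ˢ (region ℓ)ᶜ) t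
    have hw := M.meanWeight_eq hR t
    rw [hdec, M.nodeLaw_real_region] at hw
    have habs := M.abs_sum_hitProb_region_sub_le ℓ ht
    have hsucc := M.meanCount_succ hT t
    rw [← he] at hsucc
    set S := ∑ i ∈ Finset.Icc 1 t, ∫ ω, M.hitProb (region ℓ ×ˢ region ℓ) (ω.1 i)
        (inDeg (M.edges ω t) i) t ∂M.law
    set δ := S - M.ρ ℓ * (M.meanWeight (region ℓ) t / t) with hδ
    -- The deviation from `c` obeys an exact recursion with contraction constant `1 - lam`; absolute
    -- values are taken afterwards.
    have hmain : ((t : ℝ) + 1) * (e (t + 1) / ((t + 1 : ℕ) : ℝ) - c) =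
        ((t : ℝ) + 1 - (1 - lam)) * (e t / t - c) + lam * (x / t) + M.p * δ := by
      have h1 : ((t : ℝ) + 1) * (e (t + 1) / ((t + 1 : ℕ) : ℝ) - c) =
          e (t + 1) - c * ((t : ℝ) + 1) := by push_cast; field_simp
      have h2 : M.p * (M.ρ ℓ * (M.meanWeight (region ℓ) t / t)) =
          lam * (e t / t) + lam * (x / t) + c * (1 - lam) := by
        rw [hw, hcl, hlam]; field_simp
      have h3 : (t : ℝ) * (e t / t) = e t := by field_simp
      rw [h1, hsucc, hδ]
      linear_combination h2 - h3
    rw [← abs_of_pos (show (0 : ℝ) < (t : ℝ) + 1 by positivity), ← abs_mul,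
      abs_of_pos (show (0 : ℝ) < (t : ℝ) + 1 by positivity), hmain]
    refine (abs_add_le _ _).trans ?_
    refine (add_le_add_left (abs_add_le _ _) _).trans ?_
    rw [abs_mul, abs_of_nonneg (show 0 ≤ (t : ℝ) + 1 - (1 - lam) by linarith),
      abs_of_nonneg (show 0 ≤ lam * (x / t) by positivity), abs_mul, abs_of_pos hp, add_assoc]
    gcongr

/-! ### From expectations and almost sure limits to the theorem -/

open Classical in
theorem innerEdgeCount_eq (ω : M.Sample) (n : ℕ) (ℓ : M.Label) :
    (M.innerEdgeCount ω n ℓ : ℝ) = M.edgeCount (region ℓ ×ˢ region ℓ) ω n := by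
  rw [innerEdgeCount, edgeCount, Finset.card_filter]
  push_cast
  refine Finset.sum_congr rfl fun e _ => ?_
  rw [Set.indicator_apply]
  exact if_congr and_comm rfl rfl

open Classical in
theorem crossingEdgeCount_eq (ω : M.Sample) (n : ℕ) :
    (M.crossingEdgeCount ω n : ℝ) = M.edgeCount M.crossing ω n := by
  rw [crossingEdgeCount, edgeCount, Finset.card_filter]
  push_cast
  refine Finset.sum_congr rfl fun e _ => ?_
  rw [Set.indicator_apply]
  exact if_congr (not_congr (exists_congr fun _ => and_comm)) rfl rfl

/-- Subadditivity alone gives `1 - P(Eᶜ) ≤ P(E)`, so the events need not be measurable. -/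
theorem aas_of_tendsto_compl {E : ℕ → Set M.Sample}
    (h : Tendsto (fun n => M.law (E n)ᶜ) atTop (𝓝 0)) : M.AAS E := by
  have h1 : Tendsto (fun n => 1 - M.law (E n)ᶜ) atTop (𝓝 1) := by
    simpa using ENNReal.Tendsto.sub (tendsto_const_nhds (x := (1 : ENNReal))) h
      (Or.inl ENNReal.one_ne_top)
  refine tendsto_of_tendsto_of_tendsto_of_le_of_le h1 tendsto_const_nhds (fun n => ?_)
    fun n => prob_le_one
  rw [tsub_le_iff_right, ← measure_univ (μ := M.law), ← Set.union_compl_self (E n)]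
  exact measure_union_le _ _

theorem aas_crossingEdgeCount_le {ε : ℝ} (hε : 0 < ε) :
    M.AAS fun n => {ω | (M.crossingEdgeCount ω n : ℝ) ≤ ε * n} := by
  apply M.aas_of_tendsto_compl
  have hlim : Tendsto (fun n : ℕ => ENNReal.ofReal (M.meanCount M.crossing n / n / ε)) atTop
      (𝓝 0) := by
    have := M.tendsto_meanCount_crossing_div.div_const ε
    rw [zero_div] at this
    simpa using ENNReal.tendsto_ofReal this
  refine tendsto_of_tendsto_of_tendsto_of_le_of_le' tendsto_const_nhds hlim
    (Eventually.of_forall fun _ => zero_le) ?_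
  filter_upwards [eventually_ge_atTop 1] with n hn
  have hn' : (0 : ℝ) < n := by exact_mod_cast hn
  have hmk := mul_meas_ge_le_integral_of_nonneg (μ := M.law)
    (ae_of_all _ fun ω => M.edgeCount_nonneg M.crossing ω n)
    (M.integrable_edgeCount M.measurableSet_crossing n) (ε * n)
  refine (measure_mono (t := {ω | ε * n ≤ M.edgeCount M.crossing ω n}) fun ω hω => ?_).trans ?_
  · simp only [mem_compl_iff, Set.mem_ofPred_eq, not_le, M.crossingEdgeCount_eq] at hω
    exact hω.le
  · rw [← ofReal_measureReal]
    apply ENNReal.ofReal_le_ofReal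
    rw [div_div, mul_comm (n : ℝ) ε, le_div_iff₀ (by positivity), mul_comm]
    exact hmk

open Classical in
theorem nodeCount_eq (ω : M.Sample) (n : ℕ) (ℓ : M.Label) :
    (M.nodeCount ω n ℓ : ℝ) = ∑ i ∈ Finset.Icc 1 n, (region ℓ).indicator (fun _ => 1) (ω.1 i) := by
  rw [nodeCount, Finset.card_filter]
  push_cast
  exact Finset.sum_congr rfl fun i _ => by rw [Set.indicator_apply]

theorem measurable_nodeCount (n : ℕ) (ℓ : M.Label) :
    Measurable fun ω : M.Sample => (M.nodeCount ω n ℓ : ℝ) := by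
  simp only [nodeCount_eq]
  exact Finset.measurable_fun_sum _ fun i _ =>
    ((measurable_const.indicator (measurableSet_region ℓ)).comp
      (show Measurable fun ω : M.Sample => ω.1 i by fun_prop))

theorem ae_tendsto_nodeCount_div (ℓ : M.Label) :
    ∀ᵐ ω ∂M.law, Tendsto (fun n : ℕ => (M.nodeCount ω n ℓ : ℝ) / n) atTop (𝓝 (M.q ℓ)) := by
  set f : Torus M.m → ℝ := (region ℓ).indicator fun _ => 1 with hf
  have hfm : Measurable f := measurable_const.indicator (measurableSet_region ℓ)
  have hmp : MeasurePreserving (Prod.fst : M.Sample → ℕ → Torus M.m) M.law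
      (Measure.infinitePi fun _ : ℕ => M.nodeLaw) := measurePreserving_fst
  have heval : ∀ i : ℕ, MeasurePreserving (fun v : ℕ → Torus M.m => v i)
      (Measure.infinitePi fun _ : ℕ => M.nodeLaw) M.nodeLaw :=
    fun i => measurePreserving_eval_infinitePi (fun _ : ℕ => M.nodeLaw) i
  have hfi : Integrable f M.nodeLaw := (integrable_const (1 : ℝ)).indicator (measurableSet_region ℓ)
  have hfint : ∫ x, f x ∂M.nodeLaw = M.q ℓ := by
    rw [← M.nodeLaw_real_region ℓ]; exact integral_indicator_one (measurableSet_region ℓ)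
  have hslln := ProbabilityTheory.strong_law_ae_real
    (μ := Measure.infinitePi fun _ : ℕ => M.nodeLaw)
    -- The shift by one matches nodes numbered from 1.
    (fun i v => f (v (i + 1))) ((heval 1).integrable_comp_of_integrable hfi)
    (fun i j hij => (ProbabilityTheory.iIndepFun_infinitePi
      (P := fun _ : ℕ => M.nodeLaw) (X := fun _ => f) fun _ => hfm).indepFun
        (show i + 1 ≠ j + 1 by simpa using hij))
    (fun i => ProbabilityTheory.IdentDistrib.comp ⟨(heval (i + 1)).aemeasurable,
      (heval 1).aemeasurable, by rw [(heval (i + 1)).map_eq, (heval 1).map_eq]⟩ hfm)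
  have hint : ∫ v, f (v (0 + 1)) ∂(Measure.infinitePi fun _ : ℕ => M.nodeLaw) = M.q ℓ := by
    have h := integral_map (heval 1).aemeasurable (f := f) hfm.aestronglyMeasurable
    rw [(heval 1).map_eq, hfint] at h
    exact h.symm
  rw [hint] at hslln
  filter_upwards [hmp.quasiMeasurePreserving.ae hslln] with ω hω
  refine hω.congr fun n => ?_
  congr 1
  rw [nodeCount_eq, Finset.range_eq_Ico, Finset.sum_Ico_add' (fun i => f (ω.1 i)), zero_add]
  rfl

theorem q_nonneg (ℓ : M.Label) : 0 ≤ M.q ℓ :=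
  mul_nonneg (M.ρ_nonneg ℓ) (by positivity)

theorem tendsto_law_nodeCount_deviation (ℓ : M.Label) {ε : ℝ} (hε : 0 < ε) :
    Tendsto (fun n : ℕ => M.law {ω |
      ε * (M.q ℓ * n) < |(M.nodeCount ω n ℓ : ℝ) - M.q ℓ * n|}) atTop (𝓝 0) := by
  -- If `q ℓ = 0`, the relative error bound demands a count of exactly 0, which holds almost surely;
  -- otherwise convergence in measure with tolerance `ε * q ℓ` applies.
  rcases (M.q_nonneg ℓ).eq_or_lt with hq | hq
  · have hnull : ∀ᵐ ω ∂M.law, ∀ i : ℕ, ω.1 i ∉ region ℓ := by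
      rw [ae_all_iff]
      intro i
      rw [ae_iff]
      have h := M.law_real_node_mem (measurableSet_region ℓ) i
      rw [M.nodeLaw_real_region, ← hq, measureReal_eq_zero_iff] at h
      simpa using h
    refine tendsto_const_nhds.congr fun n => Eq.symm ?_
    refine measure_mono_null ?_ (ae_iff.1 hnull)
    intro ω hω hn
    rw [Set.mem_ofPred_eq, nodeCount_eq,
      Finset.sum_eq_zero fun i _ => Set.indicator_of_notMem (hn i) _, ← hq] at hω
    simp at hω
  · have hm := tendstoInMeasure_of_tendsto_ae (μ := M.law)
      (f := fun n ω => (M.nodeCount ω n ℓ : ℝ) / n) (g := fun _ => M.q ℓ)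
      (fun n => ((M.measurable_nodeCount n ℓ).div_const _).aestronglyMeasurable)
      (M.ae_tendsto_nodeCount_div ℓ)
    rw [tendstoInMeasure_iff_dist] at hm
    refine tendsto_of_tendsto_of_tendsto_of_le_of_le' tendsto_const_nhds
      (hm (ε * M.q ℓ) (by positivity)) (Eventually.of_forall fun _ => zero_le) ?_
    filter_upwards [eventually_ge_atTop 1] with n hn
    have hn' : (0 : ℝ) < n := by exact_mod_cast hn
    refine measure_mono fun ω hω => ?_
    have hω' : ε * (M.q ℓ * n) < |(M.nodeCount ω n ℓ : ℝ) - M.q ℓ * n| := hω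
    have h1 : (M.nodeCount ω n ℓ : ℝ) / n - M.q ℓ = ((M.nodeCount ω n ℓ : ℝ) - M.q ℓ * n) / n := by
      field_simp
    rw [Set.mem_ofPred_eq, Real.dist_eq, h1, abs_div, abs_of_pos hn', le_div_iff₀ hn', mul_assoc]
    exact hω'.le

theorem aas_nodeCount {ε : ℝ} (hε : 0 < ε) :
    M.AAS fun n => {ω | ∀ ℓ : M.Label,
      |(M.nodeCount ω n ℓ : ℝ) - M.q ℓ * n| ≤ ε * (M.q ℓ * n)} := by
  apply M.aas_of_tendsto_compl
  have hsum := tendsto_finsetSum (Finset.univ : Finset M.Label)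
    fun ℓ _ => M.tendsto_law_nodeCount_deviation ℓ hε
  rw [Finset.sum_const_zero] at hsum
  refine tendsto_of_tendsto_of_tendsto_of_le_of_le tendsto_const_nhds hsum
    (fun _ => zero_le) fun n => ?_
  refine (measure_mono fun ω hω => ?_).trans (measure_biUnion_finset_le Finset.univ _)
  simp only [mem_compl_iff, Set.mem_ofPred_eq, not_forall, not_le] at hω
  simpa using hω

/-- Asymptotic equivalence to the zero sequence means eventual equality, so for `ρ ℓ = 0` exact
vanishing is needed rather than a limit of the ratio to `n`. -/
theorem meanCount_region_of_ρ_eq_zero {ℓ : M.Label} (hρ : M.ρ ℓ = 0) (n : ℕ) :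
    M.meanCount (region ℓ ×ˢ region ℓ) n = 0 := by
  induction n with
  | zero => exact M.meanCount_zero _
  | succ t ih =>
    rw [M.meanCount_succ ((measurableSet_region ℓ).prod (measurableSet_region ℓ)), ih, zero_add,
      Finset.sum_eq_zero, mul_zero]
    intro i hi
    obtain ⟨h1, hit⟩ := Finset.mem_Icc.1 hi
    simp [M.hitProb_region_eq ℓ _ _ (h1.trans hit), hρ]

theorem isEquivalent_innerEdgeCount (ℓ : M.Label) :
    Asymptotics.IsEquivalent atTop
      (fun n : ℕ => ∫ ω, (M.innerEdgeCount ω n ℓ : ℝ) ∂M.law)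
      (fun n : ℕ => M.p * M.ρ ℓ * M.A₂ / (1 - M.p * M.ρ ℓ * M.A₁) * M.q ℓ * n) := by
  simp only [innerEdgeCount_eq]
  change Asymptotics.IsEquivalent atTop (fun n : ℕ => M.meanCount (region ℓ ×ˢ region ℓ) n) _
  rcases (M.ρ_nonneg ℓ).eq_or_lt with hρ | hρ
  · simp only [M.meanCount_region_of_ρ_eq_zero hρ.symm, ← hρ]
    simp only [mul_zero, zero_mul, zero_div]
    exact Asymptotics.IsEquivalent.refl
  · have hp := M.p_pos
    have hA₂ := M.A₂_pos
    have hsub := M.subcritical ℓ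
    have hk : (0 : ℝ) < M.k := by exact_mod_cast M.k_pos
    have hc : M.p * M.ρ ℓ * M.A₂ / (1 - M.p * M.ρ ℓ * M.A₁) * M.q ℓ ≠ 0 := by
      have h1 : 0 < 1 - M.p * M.ρ ℓ * M.A₁ := by linarith
      rw [q]; positivity
    have h := ((Asymptotics.isEquivalent_const_iff_tendsto hc).2
      (M.tendsto_meanCount_region_div ℓ)).mul
      (Asymptotics.IsEquivalent.refl (u := fun n : ℕ => (n : ℝ)) (l := atTop))
    refine h.congr_left ?_
    filter_upwards [eventually_ge_atTop 1] with n hn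
    have hn' : (n : ℝ) ≠ 0 := by positivity
    simp [hn']

end Model
end SPA

theorem theorem3 (M : SPA.Model) :
    (∀ ε : ℝ, 0 < ε →
      M.AAS fun n => {ω | ∀ ℓ : M.Label,
        |(M.nodeCount ω n ℓ : ℝ) - M.q ℓ * n| ≤ ε * (M.q ℓ * n)}) ∧
    (∀ ℓ : M.Label,
      (∀ n : ℕ, Integrable (fun ω => (M.innerEdgeCount ω n ℓ : ℝ)) M.law) ∧
      Asymptotics.IsEquivalent atTop
        (fun n : ℕ => ∫ ω, (M.innerEdgeCount ω n ℓ : ℝ) ∂M.law)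
        (fun n : ℕ => M.p * M.ρ ℓ * M.A₂ / (1 - M.p * M.ρ ℓ * M.A₁) * M.q ℓ * n)) ∧
    (∀ ε : ℝ, 0 < ε →
      M.AAS fun n => {ω | (M.crossingEdgeCount ω n : ℝ) ≤ ε * n}) := by
  refine ⟨fun ε hε => M.aas_nodeCount hε, fun ℓ => ⟨fun n => ?_, M.isEquivalent_innerEdgeCount ℓ⟩,
    fun ε hε => M.aas_crossingEdgeCount_le hε⟩
  simp only [M.innerEdgeCount_eq]
  exact M.integrable_edgeCount
    ((SPA.measurableSet_region ℓ).prod (SPA.measurableSet_region ℓ)) n
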